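/- Let $X_1,X_2,U_1$ be Hilbert spaces and, for $j=1,2$, let $A_j:D(A_j)\subset X_j\to X_j$ be the generator of a $C_0$-semigroup $(e^{A_jt})_{t\ge 0}$ on $X_j$. Equip $D(A_j)$ and $D(A_j^*)$ with their graph norms, let $[D(A_j^*)]'$ be the dual of $D(A_j^*)$ with respect to the pivot space $X_j$ (so that $X_j\hookrightarrow [D(A_j^*)]'$), let $\tilde A_j\in\mathcal L(X_j,[D(A_j^*)]')$ be the extension of $A_j$ given by $\langle \tilde A_jx,y\rangle_{[D(A_j^*)]',D(A_j^*)}=\langle x,A_j^*y\rangle_{X_j}$ for $x\in X_j$, $y\in D(A_j^*)$, and let $e^{\tilde A_jt}$ be the corresponding extension of the semigroup to $[D(A_j^*)]'$. Let $B_1\in\mathcal L(U_1,[D(A_1^*)]')$ be an admissible control operator for $e^{A_1t}$, i.e. for some $\tau>0$ one has $\int_0^\tau e^{\tilde A_1(\tau-s)}B_1u(s)\,ds\in X_1$ for all $u\in L^2([0,\infty);U_1)$ (the integral being taken in $[D(A_1^*)]'$). Let $C_2\in\mathcal L(D(A_2),U_1)$ be an admissible observation operator for $e^{A_2t}$, i.e.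 for some $\tau>0$ and $K\ge 0$ one has $\int_0^\tau\|C_2e^{A_2s}x\|_{U_1}^2\,ds\le K\|x\|_{X_2}^2$ for all $x\in D(A_2)$. Let $C_{2\Lambda}x=\lim_{\lambda\to+\infty}C_2\lambda(\lambda-A_2)^{-1}x$, defined for those $x\in X_2$ for which the limit exists, be the $\Lambda$-extension of $C_2$ with respect to $A_2$. Define the operator $$\mathcal A=\begin{pmatrix}\tilde A_1 & B_1C_{2\Lambda}\\ 0 & \tilde A_2\end{pmatrix},\qquad D(\mathcal A)=\left\{(x_1,x_2)^\top\in X_1\times D(A_2)\ \middle|\ \tilde A_1x_1+B_1C_{2\Lambda}x_2\in X_1\right\}.$$ Then $\mathcal A$ generates a $C_0$-semigroup $e^{\mathcal At}$ on $X_1\times X_2$. If, in addition, both $e^{A_1t}$ and $e^{A_2t}$ are exponentially stable (on $X_1$ and $X_2$ respectively), then $e^{\mathcal At}$ is exponentially stable on $X_1\times X_2$. -/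

import Mathlib

open Filter Topology MeasureTheory
open scoped NNReal ENNReal InnerProductSpace

noncomputable section

section LimitOperator

variable {𝕜 X Y ι : Type*} [RCLike 𝕜] [AddCommGroup X] [Module 𝕜 X]
  [NormedAddCommGroup Y] [NormedSpace 𝕜 Y]

/-- The pointwise limit of a family of everywhere defined linear maps along a filter `l`, as a
partially defined operator: its domain is the set of all `x` for which the limit exists in `Y`,
and its value at such an `x` is the limit. -/
def limitOperator (L : ι → X →ₗ[𝕜] Y) (l : Filter ι) [l.NeBot] : X →ₗ.[𝕜] Y where
  domain :=
    { carrier := {x | ∃ y, Tendsto (fun i => L i x) l (𝓝 y)}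
      zero_mem' := ⟨0, by simp⟩
      add_mem' := by
        rintro a b ⟨y, hy⟩ ⟨z, hz⟩
        exact ⟨y + z, by simpa using hy.add hz⟩
      smul_mem' := by
        rintro c a ⟨y, hy⟩
        exact ⟨c • y, by simpa using hy.const_smul c⟩ }
  toFun :=
    { toFun := fun x => x.2.choose
      map_add' := by
        intro a b
        refine tendsto_nhds_unique (a + b).2.choose_spec ?_
        simpa using a.2.choose_spec.add b.2.choose_spec
      map_smul' := by
        intro c a
        refine tendsto_nhds_unique (c • a).2.choose_spec ?_
        simpa using a.2.choose_spec.const_smul c }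

theorem mem_limitOperator_domain {L : ι → X →ₗ[𝕜] Y} {l : Filter ι} [l.NeBot] {x : X} :
    x ∈ (limitOperator L l).domain ↔ ∃ y, Tendsto (fun i => L i x) l (𝓝 y) := Iff.rfl

theorem tendsto_limitOperator (L : ι → X →ₗ[𝕜] Y) (l : Filter ι) [l.NeBot]
    (x : (limitOperator L l).domain) :
    Tendsto (fun i => L i x) l (𝓝 (limitOperator L l x)) := x.2.choose_spec

theorem limitOperator_apply_eq {L : ι → X →ₗ[𝕜] Y} {l : Filter ι} [l.NeBot]
    (x : (limitOperator L l).domain) {y : Y} (h : Tendsto (fun i => L i x) l (𝓝 y)) :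
    limitOperator L l x = y := tendsto_nhds_unique (tendsto_limitOperator L l x) h

end LimitOperator

/-! ### The spaces `D(A)` and `[D(A*)]'` of an unbounded operator -/

section Spaces

variable {𝕜 X : Type*} [RCLike 𝕜] [NormedAddCommGroup X] [InnerProductSpace 𝕜 X]

/-- The domain `D(A)`, as a normed space of its own (see the norm below). -/
def DomainSpace (A : X →ₗ.[𝕜] X) : Type _ := A.domain

namespace DomainSpace

variable (A : X →ₗ.[𝕜] X)

instance : AddCommGroup (DomainSpace A) := inferInstanceAs (AddCommGroup A.domain)
instance : Module 𝕜 (DomainSpace A) := inferInstanceAs (Module 𝕜 A.domain)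

/-- The inclusion `D(A) → X`. -/
def incl : DomainSpace A →ₗ[𝕜] X := A.domain.subtype

/-- The operator `A` on `D(A)`. -/
def op : DomainSpace A →ₗ[𝕜] X := A.toFun

/-- The embedding `x ↦ (x, A x)` of `D(A)` into the Hilbert space `X × X`. -/
def toGraph : DomainSpace A →ₗ[𝕜] WithLp 2 (X × X) :=
  (WithLp.linearEquiv 2 𝕜 (X × X)).symm.toLinearMap ∘ₗ (incl A).prod (op A)

theorem toGraph_injective : Function.Injective (toGraph A) := by
  intro x y h
  have h1 : incl A x = incl A y := congrArg (fun p => p.fst) h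
  exact Subtype.ext h1

/-- `D(A)` carries the graph norm `(‖x‖² + ‖A x‖²)^(1/2)`.  When the resolvent set of `A` is not
empty this is equivalent to `‖(β - A) x‖` for every `β` in the resolvent set. -/
instance : NormedAddCommGroup (DomainSpace A) :=
  NormedAddCommGroup.induced (DomainSpace A) (WithLp 2 (X × X)) (toGraph A) (toGraph_injective A)

instance : NormedSpace 𝕜 (DomainSpace A) :=
  NormedSpace.induced 𝕜 (DomainSpace A) (WithLp 2 (X × X)) (toGraph A)

variable {A}

/-- An element of the domain of `A`, as an element of the normed space `D(A)`. -/
def mk (x : X) (hx : x ∈ A.domain) : DomainSpace A := ⟨x, hx⟩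

theorem incl_mem (x : DomainSpace A) : incl A x ∈ A.domain := Subtype.property (p := (· ∈ A.domain)) x

theorem norm_sq_eq (x : DomainSpace A) : ‖x‖ ^ 2 = ‖incl A x‖ ^ 2 + ‖op A x‖ ^ 2 :=
  WithLp.prod_norm_sq_eq_of_L2 (toGraph A x)

theorem norm_incl_le (x : DomainSpace A) : ‖incl A x‖ ≤ ‖x‖ := by
  have := norm_sq_eq x
  exact le_of_sq_le_sq (by nlinarith [sq_nonneg ‖op A x‖]) (norm_nonneg _)

theorem norm_op_le (x : DomainSpace A) : ‖op A x‖ ≤ ‖x‖ := by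
  have := norm_sq_eq x
  exact le_of_sq_le_sq (by nlinarith [sq_nonneg ‖incl A x‖]) (norm_nonneg _)

end DomainSpace

variable [CompleteSpace X]

/-- `[D(A*)]'`, the dual of `D(A*)` with respect to the pivot space `X`: the Banach space of the
bounded conjugate-linear functionals `f` on `D(A*)`, the pairing `⟨f, y⟩` being `f y`. -/
abbrev ExtrapolationSpace (A : X →ₗ.[𝕜] X) : Type _ := DomainSpace A.adjoint →L⋆[𝕜] 𝕜

/-- The embedding of `X` into `[D(A*)]'`: `⟨x, y⟩_{[D(A*)]', D(A*)} = ⟨x, y⟩_X`, the scalar product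
of `X` being linear in `x` and conjugate-linear in `y` (in Mathlib: `⟪y, x⟫`). -/
def pivotEmbedding (A : X →ₗ.[𝕜] X) : X →L[𝕜] ExtrapolationSpace A :=
  LinearMap.mkContinuous₂ (LinearMap.mk₂'ₛₗ (RingHom.id 𝕜) (starRingEnd 𝕜)
      (fun x (y : DomainSpace A.adjoint) => ⟪DomainSpace.incl _ y, x⟫_𝕜)
      (fun x x' y => inner_add_right _ _ _)
      (fun c x y => by simp [inner_smul_right])
      (fun x y y' => by simp [inner_add_left])
      (fun c x y => by simp [inner_smul_left])) 1
    (fun x y => by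
      rw [one_mul, mul_comm]
      exact (norm_inner_le_norm _ _).trans
        (mul_le_mul_of_nonneg_right (DomainSpace.norm_incl_le y) (norm_nonneg x)))

/-- The extension `Ã : X → [D(A*)]'` of `A`: `⟨Ã x, y⟩_{[D(A*)]', D(A*)} = ⟨x, A* y⟩_X`. -/
def extendedOperator (A : X →ₗ.[𝕜] X) : X →L[𝕜] ExtrapolationSpace A :=
  LinearMap.mkContinuous₂ (LinearMap.mk₂'ₛₗ (RingHom.id 𝕜) (starRingEnd 𝕜)
      (fun x (y : DomainSpace A.adjoint) => ⟪DomainSpace.op _ y, x⟫_𝕜)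
      (fun x x' y => inner_add_right _ _ _)
      (fun c x y => by simp [inner_smul_right])
      (fun x y y' => by simp [inner_add_left])
      (fun c x y => by simp [inner_smul_left])) 1
    (fun x y => by
      rw [one_mul, mul_comm]
      exact (norm_inner_le_norm _ _).trans
        (mul_le_mul_of_nonneg_right (DomainSpace.norm_op_le y) (norm_nonneg x)))

theorem pivotEmbedding_apply (A : X →ₗ.[𝕜] X) (x : X) (y : DomainSpace A.adjoint) :
    pivotEmbedding A x y = ⟪DomainSpace.incl _ y, x⟫_𝕜 := rfl

theorem extendedOperator_apply (A : X →ₗ.[𝕜] X) (x : X) (y : DomainSpace A.adjoint) :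
    extendedOperator A x y = ⟪DomainSpace.op _ y, x⟫_𝕜 := rfl

/-- For a closed `A` (so for every generator of a `C₀`-semigroup) `pivotEmbedding A` is injective. -/
theorem pivotEmbedding_injective {A : X →ₗ.[𝕜] X} (hc : A.IsClosed) :
    Function.Injective (pivotEmbedding A) := by
  rw [injective_iff_map_eq_zero]
  intro z hz
  set K : Submodule 𝕜 (WithLp 2 (X × X)) :=
    A.graph.comap (WithLp.linearEquiv 2 𝕜 (X × X)).toLinearMap with hK
  have hKc : IsClosed (K : Set (WithLp 2 (X × X))) :=
    IsClosed.preimage (WithLp.prod_continuous_ofLp 2 X X) hc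
  have : CompleteSpace K := hKc.completeSpace_coe
  have h1 : WithLp.toLp 2 ((0 : X), z) ∈ Kᗮᗮ := by
    rw [Submodule.mem_orthogonal]
    intro w hw
    rw [Submodule.mem_orthogonal] at hw
    have key : ∀ x : A.domain, ⟪-w.fst, (x : X)⟫_𝕜 = ⟪w.snd, A x⟫_𝕜 := by
      intro x
      have hx := hw (WithLp.toLp 2 ((x : X), A x)) (by
        show ((x : X), A x) ∈ A.graph
        exact A.mem_graph x)
      rw [WithLp.prod_inner_apply] at hx
      have hx' := congrArg (starRingEnd 𝕜) hx
      simp only [map_add, inner_conj_symm, map_zero] at hx'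
      rw [inner_neg_left]
      exact neg_eq_of_add_eq_zero_right hx'
    have hmem : w.snd ∈ A.adjoint.domain := A.mem_adjoint_domain_of_exists _ ⟨_, key⟩
    have h0 : ⟪w.snd, z⟫_𝕜 = 0 := by
      have := congrArg (fun f => f (DomainSpace.mk w.snd hmem)) hz
      exact this
    rw [WithLp.prod_inner_apply]
    simpa using h0
  rw [Submodule.orthogonal_orthogonal] at h1
  have h2 : ((0 : X), z) ∈ A.graph := h1
  exact A.graph_fst_eq_zero_snd h2 rfl

end Spaces

/-! ### Resolvent and `Λ`-extension -/

section Resolvent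

variable {𝕜 X Y : Type*} [RCLike 𝕜] [NormedAddCommGroup X] [InnerProductSpace 𝕜 X]
  [NormedAddCommGroup Y] [NormedSpace 𝕜 Y]

/-- The map `μ - A : D(A) → X`. -/
def shiftedOperator (A : X →ₗ.[𝕜] X) (μ : 𝕜) : DomainSpace A →ₗ[𝕜] X :=
  μ • DomainSpace.incl A - DomainSpace.op A

/-- The resolvent set `ρ(A)`: `μ - A` is a bijection of `D(A)` onto `X` with bounded inverse. -/
def operatorResolventSet (A : X →ₗ.[𝕜] X) : Set 𝕜 :=
  {μ | Function.Bijective (shiftedOperator A μ) ∧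
    ∃ M : ℝ, ∀ x, ‖DomainSpace.incl A x‖ ≤ M * ‖shiftedOperator A μ x‖}

open Classical in
/-- The resolvent `(μ - A)⁻¹ : X → D(A)` for `μ ∈ ρ(A)` (and `0` for other `μ`). -/
def operatorResolvent (A : X →ₗ.[𝕜] X) (μ : 𝕜) : X →ₗ[𝕜] DomainSpace A :=
  if h : μ ∈ operatorResolventSet A then
    (LinearEquiv.ofBijective (shiftedOperator A μ) h.1).symm.toLinearMap
  else 0

/-- The `Λ`-extension `C_Λ x = lim_{μ → +∞} C μ (μ - A)⁻¹ x` of `C ∈ L(D(A), Y)`, where `A`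
generates a `C₀`-semigroup; its domain is the set of all `x ∈ X` for which the limit exists.
(Every large real `μ` belongs to `ρ(A)` then.) -/
def lambdaExtension (A : X →ₗ.[𝕜] X) (C : DomainSpace A →L[𝕜] Y) : X →ₗ.[𝕜] Y :=
  limitOperator (fun μ : ℝ => C.toLinearMap ∘ₗ ((μ : 𝕜) • operatorResolvent A (μ : 𝕜))) atTop

end Resolvent

/-! ### `C₀`-semigroups -/

/-- A strongly continuous semigroup of bounded linear operators on `X`. -/
structure C0Semigroup (𝕜 X : Type*) [RCLike 𝕜] [NormedAddCommGroup X] [NormedSpace 𝕜 X] where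
  toFun : ℝ≥0 → X →L[𝕜] X
  map_zero : toFun 0 = ContinuousLinearMap.id 𝕜 X
  map_add : ∀ s t, toFun (s + t) = (toFun s).comp (toFun t)
  tendsto_zero : ∀ x, Tendsto (fun t => toFun t x) (𝓝[>] 0) (𝓝 x)

namespace C0Semigroup

section Normed

variable {𝕜 X : Type*} [RCLike 𝕜] [NormedAddCommGroup X] [NormedSpace 𝕜 X]

/-- The infinitesimal generator `A x = lim_{t → 0+} (T(t) x - x) / t`, defined for exactly those
`x` for which the limit exists. -/
def generator (T : C0Semigroup 𝕜 X) : X →ₗ.[𝕜] X :=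
  limitOperator (fun t : ℝ≥0 => (((t : ℝ) : 𝕜)⁻¹ •
    (T.toFun t - ContinuousLinearMap.id 𝕜 X)).toLinearMap) (𝓝[>] 0)

/-- Exponential stability: `‖T(t)‖ ≤ L e^{-ω t}` for all `t ≥ 0`, with positive `L` and `ω`. -/
def ExponentiallyStable (T : C0Semigroup 𝕜 X) : Prop :=
  ∃ L > (0 : ℝ), ∃ ω > (0 : ℝ), ∀ t : ℝ≥0, ‖T.toFun t‖ ≤ L * Real.exp (-ω * t)

theorem tendsto_map_generator (T : C0Semigroup 𝕜 X) (t : ℝ≥0) (x : T.generator.domain) :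
    Tendsto (fun h : ℝ≥0 => (((h : ℝ) : 𝕜)⁻¹ •
      (T.toFun h - ContinuousLinearMap.id 𝕜 X)).toLinearMap (T.toFun t x)) (𝓝[>] 0)
      (𝓝 (T.toFun t (T.generator x))) := by
  have h := ((T.toFun t).continuous.tendsto _).comp (tendsto_limitOperator _ _ x)
  refine h.congr fun s => ?_
  have hc : T.toFun t (T.toFun s x) = T.toFun s (T.toFun t x) := by
    rw [← ContinuousLinearMap.comp_apply, ← T.map_add, add_comm, T.map_add]; rfl
  simp [map_sub, hc]

theorem map_mem_domain (T : C0Semigroup 𝕜 X) (t : ℝ≥0) (x : T.generator.domain) :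
    T.toFun t x ∈ T.generator.domain := ⟨_, T.tendsto_map_generator t x⟩

theorem generator_map (T : C0Semigroup 𝕜 X) (t : ℝ≥0) (x : T.generator.domain) :
    T.generator ⟨T.toFun t x, T.map_mem_domain t x⟩ = T.toFun t (T.generator x) :=
  limitOperator_apply_eq _ (T.tendsto_map_generator t x)

end Normed

section Hilbert

variable {𝕜 X : Type*} [RCLike 𝕜] [NormedAddCommGroup X] [InnerProductSpace 𝕜 X]

/-- `T(t) x` as an element of `D(A)`, for `x ∈ D(A)`. -/
def onDomain (T : C0Semigroup 𝕜 X) (t : ℝ≥0) (x : DomainSpace T.generator) :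
    DomainSpace T.generator :=
  DomainSpace.mk (T.toFun t (DomainSpace.incl _ x)) (T.map_mem_domain t x)

variable [CompleteSpace X]

theorem adjoint_map_mem_domain (T : C0Semigroup 𝕜 X) (t : ℝ≥0)
    (y : T.generator.adjoint.domain) :
    (T.toFun t).adjoint (y : X) ∈ T.generator.adjoint.domain := by
  rw [LinearPMap.mem_adjoint_domain_iff]
  have hy := (LinearPMap.mem_adjoint_domain_iff _ _).1 y.2
  have hcont : Continuous fun x : T.generator.domain =>
      (⟨T.toFun t x, T.map_mem_domain t x⟩ : T.generator.domain) :=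
    Continuous.subtype_mk ((T.toFun t).continuous.comp continuous_subtype_val) _
  refine (hy.comp hcont).congr fun x => ?_
  show ⟪(y : X), T.generator ⟨T.toFun t x, T.map_mem_domain t x⟩⟫_𝕜
    = ⟪(T.toFun t).adjoint (y : X), T.generator x⟫_𝕜
  rw [T.generator_map, ContinuousLinearMap.adjoint_inner_left]

theorem adjoint_generator_map (T : C0Semigroup 𝕜 X) (t : ℝ≥0)
    (y : T.generator.adjoint.domain) :
    T.generator.adjoint ⟨(T.toFun t).adjoint (y : X), T.adjoint_map_mem_domain t y⟩
      = (T.toFun t).adjoint (T.generator.adjoint y) := by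
  by_cases hd : Dense (T.generator.domain : Set X)
  · refine LinearPMap.adjoint_apply_eq hd _ fun x => ?_
    have h := LinearPMap.adjoint_isFormalAdjoint hd y ⟨T.toFun t x, T.map_mem_domain t x⟩
    rw [ContinuousLinearMap.adjoint_inner_left, ContinuousLinearMap.adjoint_inner_left,
      ← T.generator_map]
    exact h
  · rw [LinearPMap.adjoint_apply_of_not_dense hd, LinearPMap.adjoint_apply_of_not_dense hd,
      _root_.map_zero]

/-- The restriction of the adjoint `T(t)*` to `D(A*)`, a bounded operator on `D(A*)`. -/
def adjointOnDomain (T : C0Semigroup 𝕜 X) (t : ℝ≥0) :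
    DomainSpace T.generator.adjoint →L[𝕜] DomainSpace T.generator.adjoint :=
  LinearMap.mkContinuous
    { toFun := fun y => DomainSpace.mk ((T.toFun t).adjoint (DomainSpace.incl _ y))
        (T.adjoint_map_mem_domain t y)
      map_add' := fun y z => Subtype.ext ((T.toFun t).adjoint.map_add _ _)
      map_smul' := fun c y => Subtype.ext ((T.toFun t).adjoint.map_smul _ _) }
    ‖(T.toFun t).adjoint‖ (fun y => by
      set z : DomainSpace T.generator.adjoint :=
        DomainSpace.mk ((T.toFun t).adjoint (DomainSpace.incl _ y))
          (T.adjoint_map_mem_domain t y) with hz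
      show ‖z‖ ≤ _
      have h1 : ‖DomainSpace.incl _ z‖ ≤ ‖(T.toFun t).adjoint‖ * ‖DomainSpace.incl _ y‖ :=
        (T.toFun t).adjoint.le_opNorm _
      have h2 : ‖DomainSpace.op _ z‖ ≤ ‖(T.toFun t).adjoint‖ * ‖DomainSpace.op _ y‖ := by
        have h3 : DomainSpace.op _ z = (T.toFun t).adjoint (DomainSpace.op _ y) :=
          T.adjoint_generator_map t y
        rw [h3]
        exact (T.toFun t).adjoint.le_opNorm _
      refine le_of_sq_le_sq ?_ (by positivity)
      rw [mul_pow, DomainSpace.norm_sq_eq, DomainSpace.norm_sq_eq y, mul_add,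
        ← mul_pow, ← mul_pow]
      gcongr)

/-- The extension `e^{Ãt}` of the semigroup to `[D(A*)]'`:
`⟨e^{Ãt} f, y⟩ = ⟨f, T(t)* y⟩` for all `y ∈ D(A*)`. -/
def extended (T : C0Semigroup 𝕜 X) (t : ℝ≥0) :
    ExtrapolationSpace T.generator →L[𝕜] ExtrapolationSpace T.generator :=
  LinearMap.mkContinuous
    { toFun := fun f => f.comp (T.adjointOnDomain t)
      map_add' := fun _ _ => rfl
      map_smul' := fun _ _ => rfl } ‖T.adjointOnDomain t‖
    (fun f => by
      rw [mul_comm]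
      exact ContinuousLinearMap.opNorm_comp_le _ _)

theorem extended_apply (T : C0Semigroup 𝕜 X) (t : ℝ≥0) (f : ExtrapolationSpace T.generator)
    (y : DomainSpace T.generator.adjoint) :
    T.extended t f y = f (T.adjointOnDomain t y) := rfl

theorem extended_pivotEmbedding (T : C0Semigroup 𝕜 X) (t : ℝ≥0) (x : X) :
    T.extended t (pivotEmbedding T.generator x) = pivotEmbedding T.generator (T.toFun t x) := by
  ext y
  exact ContinuousLinearMap.adjoint_inner_left _ _ _

variable {U : Type*} [NormedAddCommGroup U] [NormedSpace 𝕜 U]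

/-- The input map `Φ(t) u = ∫₀ᵗ e^{Ã(t-s)} B u(s) ds`, a Bochner integral in `[D(A*)]'`. -/
def inputMap (T : C0Semigroup 𝕜 X) (B : U →L[𝕜] ExtrapolationSpace T.generator) (t : ℝ)
    (u : ℝ → U) : ExtrapolationSpace T.generator :=
  ∫ s in (0 : ℝ)..t, T.extended (t - s).toNNReal (B (u s))

/-- `B ∈ L(U, [D(A*)]')` is an admissible control operator for `T`: for some `τ > 0`, the vector
`Φ(τ) u` lies in `X` for all `u ∈ L²([0, ∞); U)`. -/
def AdmissibleControl (T : C0Semigroup 𝕜 X)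
    (B : U →L[𝕜] ExtrapolationSpace T.generator) : Prop :=
  ∃ τ > (0 : ℝ), ∀ u : ℝ → U, MemLp u 2 (volume.restrict (Set.Ici 0)) →
    ∃ x : X, pivotEmbedding T.generator x = T.inputMap B τ u

/-- `C ∈ L(D(A), Y)` is an admissible observation operator for `T`: for some `τ > 0` there is a
constant `K` with `∫₀^τ ‖C T(s) x‖² ds ≤ K ‖x‖²` for all `x ∈ D(A)`. -/
def AdmissibleObservation (T : C0Semigroup 𝕜 X) (C : DomainSpace T.generator →L[𝕜] U) : Prop :=
  ∃ τ > (0 : ℝ), ∃ K : ℝ≥0, ∀ x : DomainSpace T.generator,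
    ∫⁻ s in Set.Ioc 0 τ, ‖C (T.onDomain s.toNNReal x)‖ₑ ^ 2
      ≤ K * ‖DomainSpace.incl _ x‖ₑ ^ 2

end Hilbert

end C0Semigroup

/-! ### The cascade operator -/

section Cascade

variable {𝕜 X₁ X₂ U : Type*} [RCLike 𝕜]
  [NormedAddCommGroup X₁] [InnerProductSpace 𝕜 X₁] [CompleteSpace X₁]
  [NormedAddCommGroup X₂] [InnerProductSpace 𝕜 X₂]
  [NormedAddCommGroup U] [NormedSpace 𝕜 U]
  (A₁ : X₁ →ₗ.[𝕜] X₁) (A₂ : X₂ →ₗ.[𝕜] X₂)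
  (B₁ : U →L[𝕜] ExtrapolationSpace A₁) (C₂ : DomainSpace A₂ →L[𝕜] U)

/-- The graph of the cascade operator: the pairs `((x₁, x₂), (z₁, z₂))` with `x₂ ∈ D(A₂)`,
`z₁ = Ã₁ x₁ + B₁ C_{2Λ} x₂` in `[D(A₁*)]'` and `z₂ = A₂ x₂`. -/
def cascadeGraph : Submodule 𝕜 (WithLp 2 (X₁ × X₂) × WithLp 2 (X₁ × X₂)) where
  carrier := {p | ∃ (h : p.1.snd ∈ A₂.domain) (hΛ : p.1.snd ∈ (lambdaExtension A₂ C₂).domain),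
    pivotEmbedding A₁ p.2.fst
      = extendedOperator A₁ p.1.fst + B₁ (lambdaExtension A₂ C₂ ⟨p.1.snd, hΛ⟩) ∧
    p.2.snd = A₂ ⟨p.1.snd, h⟩}
  zero_mem' := by
    refine ⟨A₂.domain.zero_mem, (lambdaExtension A₂ C₂).domain.zero_mem, ?_, ?_⟩
    · have : lambdaExtension A₂ C₂ ⟨0, Submodule.zero_mem _⟩ = 0 :=
        (lambdaExtension A₂ C₂).map_zero
      simp [this]
    · exact A₂.map_zero.symm
  add_mem' := by
    rintro p q ⟨h, hΛ, h1, h2⟩ ⟨k, kΛ, k1, k2⟩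
    refine ⟨A₂.domain.add_mem h k, (lambdaExtension A₂ C₂).domain.add_mem hΛ kΛ, ?_, ?_⟩
    · have : lambdaExtension A₂ C₂ ⟨p.1.snd + q.1.snd, Submodule.add_mem _ hΛ kΛ⟩
          = lambdaExtension A₂ C₂ ⟨_, hΛ⟩ + lambdaExtension A₂ C₂ ⟨_, kΛ⟩ :=
        (lambdaExtension A₂ C₂).map_add ⟨_, hΛ⟩ ⟨_, kΛ⟩
      simp only [Prod.fst_add, Prod.snd_add, WithLp.add_fst, WithLp.add_snd, _root_.map_add,
        h1, k1, this]
      abel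
    · have : A₂ ⟨p.1.snd + q.1.snd, Submodule.add_mem _ h k⟩ = A₂ ⟨_, h⟩ + A₂ ⟨_, k⟩ :=
        A₂.map_add ⟨_, h⟩ ⟨_, k⟩
      simp only [Prod.fst_add, Prod.snd_add, WithLp.add_snd, h2, k2, this]
  smul_mem' := by
    rintro c p ⟨h, hΛ, h1, h2⟩
    refine ⟨A₂.domain.smul_mem c h, (lambdaExtension A₂ C₂).domain.smul_mem c hΛ, ?_, ?_⟩
    · have : lambdaExtension A₂ C₂ ⟨c • p.1.snd, Submodule.smul_mem _ c hΛ⟩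
          = c • lambdaExtension A₂ C₂ ⟨_, hΛ⟩ := (lambdaExtension A₂ C₂).map_smul c ⟨_, hΛ⟩
      simp only [Prod.smul_fst, Prod.smul_snd, WithLp.smul_fst, WithLp.smul_snd,
        _root_.map_smul, h1, this, smul_add]
    · have : A₂ ⟨c • p.1.snd, Submodule.smul_mem _ c h⟩ = c • A₂ ⟨_, h⟩ := A₂.map_smul c ⟨_, h⟩
      simp only [Prod.smul_fst, Prod.smul_snd, WithLp.smul_snd, h2, this]

/-- The cascade operator `(x₁, x₂) ↦ (Ã₁ x₁ + B₁ C_{2Λ} x₂, A₂ x₂)` on the Hilbert space `X₁ × X₂`,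
with domain `{(x₁, x₂) ∈ X₁ × D(A₂) | Ã₁ x₁ + B₁ C_{2Λ} x₂ ∈ X₁}`. -/
def cascadeOperator : WithLp 2 (X₁ × X₂) →ₗ.[𝕜] WithLp 2 (X₁ × X₂) :=
  (cascadeGraph A₁ A₂ B₁ C₂).toLinearPMap

/-- The cascade operator is well defined for a closed `A₁` (so for every generator). -/
theorem cascadeOperator_graph (hc : A₁.IsClosed) :
    (cascadeOperator A₁ A₂ B₁ C₂).graph = cascadeGraph A₁ A₂ B₁ C₂ := by
  refine Submodule.toLinearPMap_graph_eq _ ?_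
  rintro ⟨p, q⟩ ⟨h, hΛ, h1, h2⟩ (rfl : p = 0)
  have e1 : lambdaExtension A₂ C₂ ⟨0, hΛ⟩ = 0 := (lambdaExtension A₂ C₂).map_zero
  have e2 : A₂ ⟨0, h⟩ = 0 := A₂.map_zero
  have q1 : q.fst = 0 := by
    apply pivotEmbedding_injective hc
    rw [_root_.map_zero]
    refine h1.trans ?_
    show extendedOperator A₁ 0 + B₁ (lambdaExtension A₂ C₂ ⟨0, hΛ⟩) = 0
    rw [e1, _root_.map_zero, _root_.map_zero, add_zero]
  have q2 : q.snd = 0 := h2.trans e2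
  exact WithLp.ofLp_injective 2 (Prod.ext q1 q2)

end Cascade

end

namespace C0Semigroup

/-! ### Local bounds, strong continuity and a stability criterion for `C₀`-semigroups. -/

section Banach

variable {𝕜 X : Type*} [RCLike 𝕜] [NormedAddCommGroup X] [NormedSpace 𝕜 X]
  (T : C0Semigroup 𝕜 X)

/-! The semigroup is triangular, with diagonal `T₁(t)`, `T₂(t)` and corner `S(t) x = ∫₀ᵗ e^{Ã₁s} B₁
C₂ T₂(t - s) x ds`. For `x ∈ D(A₂)`, admissibility of `C₂` bounds the output in `L²` by `‖x‖`, and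
admissibility of `B₁` sends `L²` inputs boundedly into `X₁`; hence `S(t)` extends from the dense
`D(A₂)` to `X₂` (`exists_cascade_operators`).

To stay out of `[D(A₁*)]'`, fix a large real `c` and the bounded operators `R = (c - A₁)⁻¹` and `b =
(c - Ã₁)⁻¹ B₁`. Then `R S(t) x = ∫₀ᵗ T₁(s) b C₂ T₂(t - s) x ds` is an integral in `X₁`, and since
`R` is injective, identities for `S` may be checked after applying `R`. Admissibility of `B₁` now
says that `∫ T₁(s) b v(s) ds` lies in the range of `R`; by the closed graph theorem its preimage is
bounded in `v` (`AdmissibleControl.exists_bound`).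

Splitting the integral gives `S(s + t) = T₁(s) S(t) + S(s) T₂(t)`, which is the semigroup law of the
triangular family. Strong continuity holds because for `x ∈ D(A₂)` the output is bounded, so its
`L²`-norm on `(0, t)` is `O(√t)`. Differentiating at `0` after applying `R` puts the generator
inside the cascade operator. The two are equal because, for some large `d`, `d` minus the generator
is onto while `d` minus the cascade operator is injective (`generator_triangular_eq`).

If both diagonal semigroups are stable, the law for `S` makes `S(nt)` decay geometrically, so the
triangular semigroup is a strict contraction at some time, and this suffices
(`exponentiallyStable_of_norm_lt_one`). -/

theorem map_zero_apply (x : X) : T.toFun 0 x = x := by rw [T.map_zero]; rfl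

theorem map_add_apply (s t : ℝ≥0) (x : X) : T.toFun (s + t) x = T.toFun s (T.toFun t x) := by
  rw [T.map_add]; rfl

theorem map_comm_apply (s t : ℝ≥0) (x : X) :
    T.toFun s (T.toFun t x) = T.toFun t (T.toFun s x) := by
  rw [← T.map_add_apply, add_comm, T.map_add_apply]

theorem tendsto_nhds_zero (x : X) : Tendsto (fun t => T.toFun t x) (𝓝 0) (𝓝 x) := by
  have h : 𝓝 (0 : ℝ≥0) = 𝓝[>] 0 ⊔ pure 0 := by
    have hu : (Set.univ : Set ℝ≥0) = insert 0 (Set.Ioi 0) := by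
      ext t
      exact ⟨fun _ => eq_zero_or_pos t, fun _ => trivial⟩
    rw [← nhdsWithin_univ, hu, nhdsWithin_insert, sup_comm]
  rw [h, tendsto_sup]
  refine ⟨T.tendsto_zero x, ?_⟩
  rw [tendsto_pure_left]
  intro s hs
  rw [T.map_zero_apply]
  exact mem_of_mem_nhds hs

/-- Factoring out the smaller time reduces continuity of an orbit everywhere to continuity at `0`.
-/
theorem norm_sub_apply_le {M : ℝ} {a : ℝ≥0} (hM : ∀ t ≤ a, ‖T.toFun t‖ ≤ M) {s t : ℝ≥0}
    (hs : s ≤ a) (ht : t ≤ a) (x : X) :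
    ‖T.toFun t x - T.toFun s x‖ ≤ M * ‖T.toFun (nndist t s) x - x‖ := by
  wlog h : s ≤ t generalizing s t
  · rw [norm_sub_rev, nndist_comm]
    exact this ht hs (le_of_not_ge h)
  have h1 : t = s + nndist t s := by
    ext
    rw [NNReal.coe_add, coe_nndist, NNReal.dist_eq, abs_of_nonneg (sub_nonneg.2 (by exact_mod_cast h))]
    ring
  have h2 : T.toFun t x = T.toFun s (T.toFun (nndist t s) x) := by
    rw [← T.map_add_apply, ← h1]
  rw [h2, ← _root_.map_sub]
  exact (T.toFun s).le_of_opNorm_le (hM s hs) _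

variable [CompleteSpace X]

/-- Otherwise `‖T(tₙ)‖ > n` along some `tₙ → 0`, although every orbit `T(tₙ) x` converges; this
contradicts Banach–Steinhaus. -/
theorem exists_norm_le_near_zero : ∃ δ > (0 : ℝ≥0), ∃ M : ℝ, ∀ t ≤ δ, ‖T.toFun t‖ ≤ M := by
  by_contra! H
  have h0 : ∀ n : ℕ, (0 : ℝ≥0) < 1 / (n + 1) := fun n => by positivity
  choose t ht hM using fun n : ℕ => H (1 / (n + 1)) (h0 n) n
  have htl : Tendsto t atTop (𝓝 0) :=
    tendsto_of_tendsto_of_tendsto_of_le_of_le tendsto_const_nhds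
      tendsto_one_div_add_atTop_nhds_zero_nat (fun _ => zero_le) ht
  obtain ⟨C, hC⟩ := banach_steinhaus (g := fun n => T.toFun (t n)) fun x => by
    have := ((T.tendsto_nhds_zero x).comp htl).norm.bddAbove_range
    obtain ⟨C, hC⟩ := this
    exact ⟨C, fun n => hC ⟨n, rfl⟩⟩
  obtain ⟨n, hn⟩ := exists_nat_gt C
  linarith [hM n, hC n]

theorem exists_norm_le (a : ℝ≥0) : ∃ M > (0 : ℝ), ∀ t ≤ a, ‖T.toFun t‖ ≤ M := by
  obtain ⟨δ, hδ, M, hM⟩ := T.exists_norm_le_near_zero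
  have key : ∀ n : ℕ, ∃ K > (0 : ℝ), ∀ t ≤ n • δ, ‖T.toFun t‖ ≤ K := by
    intro n
    induction n with
    | zero =>
      refine ⟨‖T.toFun 0‖ + 1, by positivity, fun t ht => ?_⟩
      rw [zero_smul] at ht
      rw [le_antisymm ht zero_le]
      linarith
    | succ n ih =>
      obtain ⟨K, hK, hb⟩ := ih
      refine ⟨max K (M * K), lt_max_of_lt_left hK, fun t ht => ?_⟩
      rcases le_total t (n • δ) with h | h
      · exact (hb t h).trans (le_max_left _ _)
      · have h1 : t - n • δ ≤ δ := by
          rw [tsub_le_iff_left, ← succ_nsmul]; exact ht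
        have h2 : t = (t - n • δ) + n • δ := (tsub_add_cancel_of_le h).symm
        rw [h2, T.map_add]
        refine (ContinuousLinearMap.opNorm_comp_le _ _).trans ((mul_le_mul (hM _ h1)
          (hb _ le_rfl) (norm_nonneg _) ?_).trans (le_max_right _ _))
        exact (norm_nonneg _).trans (hM _ h1)
  obtain ⟨n, hn⟩ := Archimedean.arch a hδ
  obtain ⟨K, hK, hb⟩ := key n
  exact ⟨K, hK, fun t ht => hb t (ht.trans hn)⟩

theorem continuous_uncurry : Continuous fun p : ℝ≥0 × X => T.toFun p.1 p.2 := by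
  rw [continuous_iff_continuousAt]
  rintro ⟨t, x⟩
  obtain ⟨M, hM0, hM⟩ := T.exists_norm_le (t + 1)
  rw [ContinuousAt, tendsto_iff_norm_sub_tendsto_zero]
  have hd : Tendsto (fun p : ℝ≥0 × X => nndist p.1 t) (𝓝 (t, x)) (𝓝 0) := by
    have : Continuous fun p : ℝ≥0 × X => nndist p.1 t := by fun_prop
    simpa using this.tendsto (t, x)
  have h1 := (((T.tendsto_nhds_zero x).comp hd).sub_const x).norm.const_mul M
  have h2 : Tendsto (fun p : ℝ≥0 × X => M * ‖p.2 - x‖) (𝓝 (t, x)) (𝓝 0) := by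
    have : Continuous fun p : ℝ≥0 × X => M * ‖p.2 - x‖ := by fun_prop
    simpa using this.tendsto (t, x)
  have h3 := h2.add h1
  simp only [sub_self, norm_zero, mul_zero, add_zero] at h3
  refine squeeze_zero' (Eventually.of_forall fun _ => norm_nonneg _) ?_ h3
  have hev : ∀ᶠ p : ℝ≥0 × X in 𝓝 (t, x), p.1 ≤ t + 1 :=
    continuous_fst.continuousAt.eventually (Iic_mem_nhds (by simp))
  filter_upwards [hev] with p hp
  calc ‖T.toFun p.1 p.2 - T.toFun t x‖
      = ‖T.toFun p.1 (p.2 - x) + (T.toFun p.1 x - T.toFun t x)‖ := by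
        rw [_root_.map_sub]; congr 1; abel
    _ ≤ _ := (norm_add_le _ _).trans (add_le_add ((T.toFun p.1).le_of_opNorm_le (hM _ hp) _)
        (T.norm_sub_apply_le hM (by simp) hp x))

theorem continuous_apply (x : X) : Continuous fun t => T.toFun t x :=
  T.continuous_uncurry.comp (Continuous.prodMk_left x)

theorem continuous_orbit (x : X) : Continuous fun s : ℝ => T.toFun s.toNNReal x :=
  (T.continuous_apply x).comp continuous_real_toNNReal

/-- A `C₀`-semigroup which is a strict contraction at some time is exponentially stable. -/
theorem exponentiallyStable_of_norm_lt_one {t₀ : ℝ≥0} (h0 : 0 < t₀) (h1 : ‖T.toFun t₀‖ < 1) :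
    T.ExponentiallyStable := by
  obtain ⟨M, hM0, hM⟩ := T.exists_norm_le t₀
  -- Taking `q` strictly positive keeps `log q` meaningful even if `T(t₀) = 0`.
  obtain ⟨q, hq, hq1⟩ := exists_between (max_lt h1 one_pos)
  have hq0 : 0 < q := (le_max_right _ _).trans_lt hq
  have hT : ‖T.toFun t₀‖ ≤ q := (le_max_left _ _).trans hq.le
  have hlog : Real.log q < 0 := Real.log_neg hq0 hq1
  have h0' : (0 : ℝ) < t₀ := h0
  have hn : ∀ (n : ℕ) (r : ℝ≥0), r ≤ t₀ → ‖T.toFun (n • t₀ + r)‖ ≤ q ^ n * M := by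
    intro n r hr
    induction n with
    | zero => simpa using hM r hr
    | succ n ih =>
      rw [succ_nsmul', add_assoc, T.map_add, pow_succ', mul_assoc]
      exact (ContinuousLinearMap.opNorm_comp_le _ _).trans
        (mul_le_mul hT ih (norm_nonneg _) hq0.le)
  refine ⟨M / q, by positivity, -Real.log q / t₀, div_pos (by linarith) h0', fun t => ?_⟩
  set n := ⌊t / t₀⌋₊ with hnd
  have e1 : (n : ℝ≥0) ≤ t / t₀ := Nat.floor_le zero_le
  have e2 : t / t₀ < n + 1 := Nat.lt_floor_add_one _
  have e3 : n • t₀ ≤ t := by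
    rw [nsmul_eq_mul]; exact (le_div_iff₀ h0).1 e1
  have e4 : t - n • t₀ ≤ t₀ := by
    rw [tsub_le_iff_left, ← succ_nsmul, nsmul_eq_mul]
    push_cast
    exact ((div_lt_iff₀ h0).1 e2).le
  have h := hn n _ e4
  rw [add_tsub_cancel_of_le e3] at h
  refine h.trans ?_
  -- The right side is `q ^ (t / t₀)` and `t / t₀ < n + 1`; this extra factor `q` is why the
  -- constant is `M / q`.
  have e5 : q ^ n * q ≤ Real.exp (-(-Real.log q / t₀) * t) := by
    rw [← pow_succ, ← Real.exp_log (pow_pos hq0 (n + 1)), Real.exp_le_exp, Real.log_pow]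
    have : ((t : ℝ) / t₀) ≤ n + 1 := by exact_mod_cast e2.le
    have h6 : -(-Real.log q / t₀) * t = (t / t₀) * Real.log q := by ring
    rw [h6]
    push_cast
    exact mul_le_mul_of_nonpos_right this hlog.le
  calc q ^ n * M = M / q * (q ^ n * q) := by field_simp
    _ ≤ _ := by gcongr

end Banach

end C0Semigroup

theorem NNReal.tendsto_coe_nhdsGT_zero :
    Tendsto (fun t : ℝ≥0 => (t : ℝ)) (𝓝[>] 0) (𝓝[≠] 0) := by
  refine tendsto_nhdsWithin_iff.2 ⟨?_, ?_⟩
  · exact (NNReal.continuous_coe.tendsto 0).mono_left nhdsWithin_le_nhds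
  · filter_upwards [self_mem_nhdsWithin] with t ht
    exact (NNReal.coe_pos.2 ht).ne'

namespace C0Semigroup

/-! ### The generator, integrated orbits and large real resolvent points. -/

section Generator

variable {𝕜 X : Type*} [RCLike 𝕜] [NormedAddCommGroup X] [NormedSpace 𝕜 X]
  (T : C0Semigroup 𝕜 X)

theorem mem_graph_generator {x y : X} :
    (x, y) ∈ T.generator.graph ↔
      Tendsto (fun h : ℝ≥0 => ((h : ℝ) : 𝕜)⁻¹ • (T.toFun h x - x)) (𝓝[>] 0) (𝓝 y) := by
  rw [LinearPMap.mem_graph_iff]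
  constructor
  · rintro ⟨z, rfl, hz⟩
    simp only at hz
    rw [← hz]
    exact tendsto_limitOperator _ _ z
  · intro h
    exact ⟨⟨x, y, h⟩, rfl, limitOperator_apply_eq _ h⟩

/-- The semigroup `e^{-ct} T(t)`. -/
noncomputable def rescale (c : ℝ) : C0Semigroup 𝕜 X where
  toFun t := ((Real.exp (-c * t) : ℝ) : 𝕜) • T.toFun t
  map_zero := by simp [T.map_zero]
  map_add s t := by
    ext x
    have : Real.exp (-c * ((s + t : ℝ≥0) : ℝ)) = Real.exp (-c * s) * Real.exp (-c * t) := by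
      rw [← Real.exp_add]; push_cast; ring_nf
    simp only [this, T.map_add, _root_.smul_apply, ContinuousLinearMap.comp_apply,
      _root_.map_smul, smul_smul, RCLike.ofReal_mul]
    rw [mul_comm]
  tendsto_zero x := by
    have h1 : Continuous fun t : ℝ≥0 => ((Real.exp (-c * t) : ℝ) : 𝕜) :=
      RCLike.continuous_ofReal.comp (by fun_prop)
    have h2 : Tendsto (fun t : ℝ≥0 => ((Real.exp (-c * t) : ℝ) : 𝕜)) (𝓝[>] 0) (𝓝 1) := by
      simpa using (h1.tendsto 0).mono_left nhdsWithin_le_nhds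
    simpa using h2.smul (T.tendsto_zero x)

theorem rescale_apply (c : ℝ) (t : ℝ≥0) (x : X) :
    (T.rescale c).toFun t x = ((Real.exp (-c * t) : ℝ) : 𝕜) • T.toFun t x := rfl

theorem rescale_rescale_neg (c : ℝ) : (T.rescale c).rescale (-c) = T := by
  cases T
  simp only [rescale, mk.injEq]
  funext t
  rw [smul_smul, ← RCLike.ofReal_mul, ← Real.exp_add]
  simp

theorem norm_rescale (c : ℝ) (t : ℝ≥0) :
    ‖(T.rescale c).toFun t‖ = Real.exp (-c * t) * ‖T.toFun t‖ := by
  show ‖((Real.exp (-c * t) : ℝ) : 𝕜) • T.toFun t‖ = _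
  rw [norm_smul, RCLike.norm_ofReal, abs_of_pos (Real.exp_pos _)]

/-- Product rule at `0` for `e^{-ct} T(t) x`. -/
theorem mem_graph_generator_rescale_of_mem (c : ℝ) {x y : X} (h : (x, y) ∈ T.generator.graph) :
    (x, y - (c : 𝕜) • x) ∈ (T.rescale c).generator.graph := by
  rw [mem_graph_generator] at h ⊢
  have hd : HasDerivAt (fun t : ℝ => Real.exp (-c * t)) (-c) 0 := by
    simpa using ((hasDerivAt_id (0 : ℝ)).const_mul (-c)).exp
  have h1 := (hasDerivAt_iff_tendsto_slope_zero.1 hd).comp NNReal.tendsto_coe_nhdsGT_zero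
  have h2 := ((RCLike.continuous_ofReal (K := 𝕜)).tendsto _).comp h1
  have hc : Continuous fun t : ℝ≥0 => ((Real.exp (-c * t) : ℝ) : 𝕜) :=
    RCLike.continuous_ofReal.comp (by fun_prop)
  have h3 : Tendsto (fun t : ℝ≥0 => ((Real.exp (-c * t) : ℝ) : 𝕜)) (𝓝[>] 0) (𝓝 1) := by
    simpa using (hc.tendsto 0).mono_left nhdsWithin_le_nhds
  have h4 := (h3.smul h).add (h2.smul_const x)
  rw [one_smul, RCLike.ofReal_neg, neg_smul, ← sub_eq_add_neg] at h4
  refine h4.congr fun t => ?_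
  simp only [Function.comp, rescale_apply, zero_add, mul_zero, Real.exp_zero, smul_eq_mul,
    RCLike.ofReal_mul, RCLike.ofReal_inv, RCLike.ofReal_sub, RCLike.ofReal_one]
  module

theorem mem_graph_generator_rescale (c : ℝ) {x y : X} :
    (x, y) ∈ (T.rescale c).generator.graph ↔ (x, y + (c : 𝕜) • x) ∈ T.generator.graph := by
  constructor
  · intro h
    have := (T.rescale c).mem_graph_generator_rescale_of_mem (-c) h
    rw [rescale_rescale_neg] at this
    simpa using this
  · intro h
    simpa using T.mem_graph_generator_rescale_of_mem c h

theorem map_mem_graph (t : ℝ≥0) {x y : X} (h : (x, y) ∈ T.generator.graph) :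
    (T.toFun t x, T.toFun t y) ∈ T.generator.graph := by
  rw [mem_graph_generator] at h ⊢
  refine (((T.toFun t).continuous.tendsto _).comp h).congr fun s => ?_
  simp only [Function.comp, _root_.map_smul, _root_.map_sub, T.map_comm_apply t s]

theorem mem_domain_of_mem_graph {x y : X} (h : (x, y) ∈ T.generator.graph) :
    x ∈ T.generator.domain := LinearPMap.mem_domain_of_mem_graph h

variable [NormedSpace ℝ X]

/-- The source of the `1 / c` decay of the resolvent: `∫₀¹ e^{-cs} ds ≤ 1 / c`. -/
theorem norm_integral_rescale_le {M : ℝ} (hM0 : 0 < M) (hM : ∀ t ≤ 1, ‖T.toFun t‖ ≤ M) {c : ℝ}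
    (hc : 0 < c) (z : X) :
    ‖∫ s in (0 : ℝ)..(1 : ℝ≥0), (T.rescale c).toFun s.toNNReal z‖ ≤ M / c * ‖z‖ := by
  have hd : ∀ s : ℝ, HasDerivAt (fun s => -(M * ‖z‖ / c) * Real.exp (-c * s))
      (M * ‖z‖ * Real.exp (-c * s)) s := fun s => by
    have := (((hasDerivAt_id s).const_mul (-c)).exp).const_mul (-(M * ‖z‖ / c))
    refine this.congr_deriv ?_
    field_simp
    simp
  have hcont : Continuous fun s : ℝ => M * ‖z‖ * Real.exp (-c * s) := by fun_prop
  have h1 : ‖∫ s in (0 : ℝ)..(1 : ℝ≥0), (T.rescale c).toFun s.toNNReal z‖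
      ≤ ∫ s in (0 : ℝ)..(1 : ℝ≥0), M * ‖z‖ * Real.exp (-c * s) := by
    refine intervalIntegral.norm_integral_le_of_norm_le (by simp)
      (Eventually.of_forall fun s hs => ?_) (hcont.intervalIntegrable _ _)
    have hs1 : s.toNNReal ≤ 1 := Real.toNNReal_le_iff_le_coe.2 hs.2
    have := ((T.rescale c).toFun s.toNNReal).le_opNorm z
    rw [norm_rescale, Real.coe_toNNReal _ hs.1.le] at this
    refine this.trans ?_
    have h2 := hM _ hs1
    calc _ ≤ Real.exp (-c * s) * M * ‖z‖ := by gcongr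
      _ = _ := by ring
  rw [intervalIntegral.integral_eq_sub_of_hasDerivAt (fun s _ => hd s)
    (hcont.intervalIntegrable _ _)] at h1
  refine h1.trans ?_
  have h2 : 0 ≤ M * ‖z‖ / c := by positivity
  have h3 := (Real.exp_pos (-c * (1 : ℝ≥0))).le
  simp only [mul_zero, Real.exp_zero]
  have h4 : M / c * ‖z‖ = M * ‖z‖ / c := by ring
  rw [h4]
  nlinarith [mul_nonneg h2 h3]

variable [CompleteSpace X]

/-- `T(h)` shifts the window of integration by `h`, so the difference quotient is the average of the
orbit over `[t, t + h]` minus that over `[0, h]`. -/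
theorem integral_mem_graph (x : X) (t : ℝ≥0) :
    (∫ s in (0 : ℝ)..t, T.toFun s.toNNReal x, T.toFun t x - x) ∈ T.generator.graph := by
  rw [mem_graph_generator]
  set f : ℝ → X := fun s => T.toFun s.toNNReal x with hf
  have hfc : Continuous f := T.continuous_orbit x
  have hi : ∀ a b, IntervalIntegrable f volume a b := fun a b => hfc.intervalIntegrable a b
  have hder : ∀ r, HasDerivAt (fun u => ∫ s in (0 : ℝ)..u, f s) (f r) r := fun r =>
    intervalIntegral.integral_hasDerivAt_right (hi _ _) (hfc.stronglyMeasurableAtFilter _ _)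
      hfc.continuousAt
  have h1 := ((hasDerivAt_iff_tendsto_slope_zero.1 (hder t)).sub
    (hasDerivAt_iff_tendsto_slope_zero.1 (hder 0))).comp NNReal.tendsto_coe_nhdsGT_zero
  have h2 : f t - f 0 = T.toFun t x - x := by simp [hf, T.map_zero_apply]
  rw [h2] at h1
  refine h1.congr fun h => ?_
  have h3 : T.toFun h (∫ s in (0 : ℝ)..t, f s) = ∫ s in (h : ℝ)..(t + h), f s := by
    rw [← ContinuousLinearMap.intervalIntegral_comp_comm _ (hi _ _)]
    have := intervalIntegral.integral_comp_add_right (a := 0) (b := (t : ℝ)) f (h : ℝ)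
    rw [zero_add] at this
    rw [← this]
    refine intervalIntegral.integral_congr fun s hs => ?_
    rw [Set.uIcc_of_le t.coe_nonneg] at hs
    simp only [hf]
    rw [← T.map_add_apply, add_comm h, Real.toNNReal_add hs.1 h.coe_nonneg, Real.toNNReal_coe]
  rw [h3, ← RCLike.ofReal_inv, ← RCLike.real_smul_eq_coe_smul (K := 𝕜)]
  simp only [Function.comp, intervalIntegral.integral_same, zero_add, sub_zero]
  rw [← smul_sub]
  congr 1
  rw [← intervalIntegral.integral_interval_sub_left (hi 0 (t + h)) (hi 0 h)]
  abel

/-- The bounded operator `x ↦ ∫₀ᵗ T(s) x ds`. -/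
theorem exists_integral_clm (t : ℝ≥0) :
    ∃ J : X →L[𝕜] X, ∀ x, J x = ∫ s in (0 : ℝ)..t, T.toFun s.toNNReal x := by
  obtain ⟨M, hM0, hM⟩ := T.exists_norm_le t
  refine ⟨LinearMap.mkContinuous
    { toFun := fun x => ∫ s in (0 : ℝ)..t, T.toFun s.toNNReal x
      map_add' := fun x y => ?_
      map_smul' := fun c x => ?_ } (M * t) fun x => ?_, fun x => rfl⟩
  · simp only [_root_.map_add]
    exact intervalIntegral.integral_add ((T.continuous_orbit x).intervalIntegrable _ _)
      ((T.continuous_orbit y).intervalIntegrable _ _)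
  · simp only [_root_.map_smul, RingHom.id_apply]
    exact intervalIntegral.integral_smul c _
  · show ‖∫ s in (0 : ℝ)..t, T.toFun s.toNNReal x‖ ≤ _
    have := intervalIntegral.norm_integral_le_of_norm_le_const (a := 0) (b := (t : ℝ))
      (C := M * ‖x‖) (f := fun s => T.toFun s.toNNReal x) fun s hs => by
        rw [Set.uIoc_of_le t.coe_nonneg] at hs
        exact (T.toFun _).le_of_opNorm_le (hM _ (Real.toNNReal_le_iff_le_coe.2 hs.2)) _
    rw [sub_zero, abs_of_nonneg t.coe_nonneg] at this
    linarith

/-- Integration over `[0, t]` is a bounded operator commuting with the semigroup. It therefore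
carries the difference quotients of `x` to those of the integrated orbit, whose limit is already
known. -/
theorem integral_eq_of_mem_graph {x y : X} (h : (x, y) ∈ T.generator.graph) (t : ℝ≥0) :
    ∫ s in (0 : ℝ)..t, T.toFun s.toNNReal y = T.toFun t x - x := by
  obtain ⟨J, hJ⟩ := T.exists_integral_clm t
  have h1 := (J.continuous.tendsto _).comp (T.mem_graph_generator.1 h)
  have h2 := T.mem_graph_generator.1 (T.integral_mem_graph x t)
  rw [← hJ]
  refine tendsto_nhds_unique h1 (h2.congr fun s => ?_)
  show _ = J (_ • (T.toFun s x - x))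
  rw [_root_.map_smul, _root_.map_sub, hJ, hJ]
  congr 2
  rw [← ContinuousLinearMap.intervalIntegral_comp_comm _
    ((T.continuous_orbit x).intervalIntegrable _ _)]
  exact intervalIntegral.integral_congr fun r _ => T.map_comm_apply _ _ _

theorem tendsto_average (x : X) :
    Tendsto (fun t : ℝ≥0 => ((t : ℝ) : 𝕜)⁻¹ • ∫ s in (0 : ℝ)..t, T.toFun s.toNNReal x) (𝓝[>] 0)
      (𝓝 x) := by
  set f : ℝ → X := fun s => T.toFun s.toNNReal x with hf
  have hfc : Continuous f := T.continuous_orbit x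
  have hder : HasDerivAt (fun u => ∫ s in (0 : ℝ)..u, f s) (f 0) 0 :=
    intervalIntegral.integral_hasDerivAt_right (hfc.intervalIntegrable _ _)
      (hfc.stronglyMeasurableAtFilter _ _) hfc.continuousAt
  have h1 := (hasDerivAt_iff_tendsto_slope_zero.1 hder).comp NNReal.tendsto_coe_nhdsGT_zero
  have h2 : f 0 = x := by simp [hf, T.map_zero_apply]
  rw [h2] at h1
  refine h1.congr fun h => ?_
  rw [← RCLike.ofReal_inv, ← RCLike.real_smul_eq_coe_smul (K := 𝕜)]
  simp

/-- Trades the limit defining the generator for identities between bounded operators, which are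
closed conditions on `(x, y)`. -/
theorem mem_graph_generator_iff_integral {x y : X} :
    (x, y) ∈ T.generator.graph ↔
      ∀ t : ℝ≥0, ∫ s in (0 : ℝ)..t, T.toFun s.toNNReal y = T.toFun t x - x := by
  refine ⟨T.integral_eq_of_mem_graph, fun h => ?_⟩
  rw [mem_graph_generator]
  simpa only [h] using T.tendsto_average y

theorem isClosed_generator : T.generator.IsClosed := by
  have : (T.generator.graph : Set (X × X)) =
      ⋂ t : ℝ≥0, {p | ∫ s in (0 : ℝ)..t, T.toFun s.toNNReal p.2 = T.toFun t p.1 - p.1} := by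
    ext ⟨x, y⟩
    simp only [SetLike.mem_coe, Set.mem_iInter, Set.mem_ofPred_eq]
    exact T.mem_graph_generator_iff_integral
  rw [LinearPMap.IsClosed, this]
  refine isClosed_iInter fun t => ?_
  obtain ⟨J, hJ⟩ := T.exists_integral_clm t
  simp only [← hJ]
  exact isClosed_eq (by fun_prop) (by fun_prop)

theorem dense_generator_domain : Dense (T.generator.domain : Set X) := by
  intro x
  refine mem_closure_of_tendsto (T.tendsto_average x) (Eventually.of_forall fun t => ?_)
  exact T.generator.domain.smul_mem _ (T.mem_domain_of_mem_graph (T.integral_mem_graph x t))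

/-- The integral identity reads `(T(t) - 1) x = ∫₀ᵗ T(s) y ds`, and `1 - T(t)` is bounded below by
`1 / 2`. -/
theorem norm_le_of_mem_graph {t : ℝ≥0} (ht : ‖T.toFun t‖ ≤ 1 / 2) {K : ℝ}
    (hK : ∀ z, ‖∫ s in (0 : ℝ)..t, T.toFun s.toNNReal z‖ ≤ K * ‖z‖) {x y : X}
    (h : (x, y) ∈ T.generator.graph) : ‖x‖ ≤ 2 * K * ‖y‖ := by
  have h1 := hK y
  rw [T.integral_eq_of_mem_graph h] at h1
  have h2 := (T.toFun t).le_of_opNorm_le ht x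
  have h3 : ‖x‖ ≤ ‖T.toFun t x‖ + ‖T.toFun t x - x‖ := by
    calc ‖x‖ = ‖T.toFun t x - (T.toFun t x - x)‖ := by congr 1; abel
      _ ≤ _ := norm_sub_le _ _
  linarith

/-- Inverting `1 - T(t)` by a Neumann series solves `A x = z` with an integral over a finite
interval, so no Laplace transform on the half-line is needed. -/
theorem exists_mem_graph {t : ℝ≥0} (ht : ‖T.toFun t‖ ≤ 1 / 2) (z : X) :
    ∃ x, (x, z) ∈ T.generator.graph := by
  have hu : IsUnit (1 - T.toFun t) := isUnit_one_sub_of_norm_lt_one (by linarith)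
  obtain ⟨V, hV⟩ := hu.exists_right_inv
  refine ⟨-∫ s in (0 : ℝ)..t, T.toFun s.toNNReal (V z), ?_⟩
  have h1 := T.generator.graph.neg_mem (T.integral_mem_graph (V z) t)
  have h2 : V z - T.toFun t (V z) = z := by
    have := congrArg (fun S : X →L[𝕜] X => S z) hV
    exact this
  rw [Prod.neg_mk, neg_sub, h2] at h1
  exact h1

/-- For large real `c` the operator `c - A` is a bijection of `D(A)` onto `X`, and
`‖(c - A)⁻¹‖ ≤ M / c`. -/
theorem exists_resolvent_bound : ∃ M > (0 : ℝ), ∀ᶠ c : ℝ in atTop,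
    (∀ x y, (x, y) ∈ T.generator.graph → ‖x‖ ≤ M / c * ‖(c : 𝕜) • x - y‖) ∧
    ∀ z, ∃ x, (x, (c : 𝕜) • x - z) ∈ T.generator.graph := by
  obtain ⟨M, hM0, hM⟩ := T.exists_norm_le 1
  -- The factor `2` is the one lost in `norm_le_of_mem_graph`, applied to `e^{-ct} T(t)` at time
  -- `1`.
  refine ⟨2 * M, by positivity, ?_⟩
  have h1 : Tendsto (fun c : ℝ => Real.exp (-c) * M) atTop (𝓝 0) := by
    simpa using (Real.tendsto_exp_neg_atTop_nhds_zero.mul_const M)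
  filter_upwards [h1.eventually_le_const (by norm_num : (0 : ℝ) < 1 / 2), eventually_gt_atTop 0]
    with c hc hc0
  have h2 : ‖(T.rescale c).toFun 1‖ ≤ 1 / 2 := by
    rw [norm_rescale]
    refine le_trans ?_ hc
    simpa using mul_le_mul_of_nonneg_left (hM 1 le_rfl) (Real.exp_pos (-c)).le
  constructor
  · intro x y h
    have h3 := T.mem_graph_generator_rescale_of_mem c h
    have h4 := (T.rescale c).norm_le_of_mem_graph h2 (T.norm_integral_rescale_le hM0 hM hc0) h3
    rw [norm_sub_rev] at h4
    rwa [mul_div_assoc]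
  · intro z
    obtain ⟨x, hx⟩ := (T.rescale c).exists_mem_graph h2 (-z)
    rw [mem_graph_generator_rescale] at hx
    exact ⟨x, by rwa [sub_eq_neg_add]⟩

end Generator

/-! ### Resolvents as bounded operators on `X`. -/

section ResolventOperator

variable {𝕜 X : Type*} [RCLike 𝕜] [NormedAddCommGroup X] [NormedSpace 𝕜 X]

/-- `R` is the inverse of `c - A`, where `A` is the generator of `T`. -/
structure IsResolvent (T : C0Semigroup 𝕜 X) (c : ℝ) (R : X →L[𝕜] X) : Prop where
  mem_graph : ∀ z, (R z, (c : 𝕜) • R z - z) ∈ T.generator.graph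
  apply_sub : ∀ x y, (x, y) ∈ T.generator.graph → R ((c : 𝕜) • x - y) = x

namespace IsResolvent

variable {T : C0Semigroup 𝕜 X} {c : ℝ} {R : X →L[𝕜] X} (h : T.IsResolvent c R)
include h

theorem injective : Function.Injective R := by
  rw [injective_iff_map_eq_zero]
  intro z hz
  have h1 := h.mem_graph z
  rw [hz, smul_zero, zero_sub] at h1
  exact neg_eq_zero.1 (T.generator.graph_fst_eq_zero_snd h1 rfl)

theorem map_comm (t : ℝ≥0) (z : X) : R (T.toFun t z) = T.toFun t (R z) := by
  have h1 := h.apply_sub _ _ (T.map_mem_graph t (h.mem_graph z))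
  rwa [_root_.map_sub (T.toFun t), _root_.map_smul (T.toFun t), sub_sub_cancel] at h1

theorem mem_graph_iff {x y : X} : (x, y) ∈ T.generator.graph ↔ R ((c : 𝕜) • x - y) = x := by
  refine ⟨h.apply_sub x y, fun hx => ?_⟩
  have := h.mem_graph ((c : 𝕜) • x - y)
  rwa [hx, sub_sub_cancel] at this

end IsResolvent

variable (T : C0Semigroup 𝕜 X) [NormedSpace ℝ X] [CompleteSpace X]

/-- The resolvent estimate gives uniqueness of solutions, hence linearity of the chosen inverse, as
well as its boundedness. -/
theorem eventually_exists_isResolvent : ∀ᶠ c : ℝ in atTop, ∃ R, T.IsResolvent c R := by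
  obtain ⟨M, hM0, hM⟩ := T.exists_resolvent_bound
  filter_upwards [hM] with c ⟨hb, hs⟩
  have huniq : ∀ x x' z, (x, (c : 𝕜) • x - z) ∈ T.generator.graph →
      (x', (c : 𝕜) • x' - z) ∈ T.generator.graph → x = x' := by
    intro x x' z hx hx'
    have h1 := hb _ _ (T.generator.graph.sub_mem hx hx')
    have h2 : (c : 𝕜) • (x - x') - ((c : 𝕜) • x - z - ((c : 𝕜) • x' - z)) = 0 := by
      rw [smul_sub]; abel
    simp only at h1
    rw [h2, norm_zero, mul_zero] at h1
    exact sub_eq_zero.1 (norm_le_zero_iff.1 h1)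
  choose r hr using hs
  refine ⟨LinearMap.mkContinuous
    { toFun := r
      map_add' := fun x y => huniq _ _ _ (hr _) ?_
      map_smul' := fun a x => huniq _ _ _ (hr _) ?_ } (M / c) fun x => ?_, hr,
      fun x y hxy => huniq _ _ _ (hr _) ?_⟩
  · have := T.generator.graph.add_mem (hr x) (hr y)
    convert this using 1
    ext <;> simp only [Prod.fst_add, Prod.snd_add, smul_add]
    abel
  · have := T.generator.graph.smul_mem a (hr x)
    convert this using 1
    ext <;> simp only [Prod.smul_fst, Prod.smul_snd, smul_sub, RingHom.id_apply, smul_comm a]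
  · have := hb _ _ (hr x)
    rwa [sub_sub_cancel] at this
  · rwa [sub_sub_cancel]

/-- `c (c - A)⁻¹ z → z` as `c → +∞`. -/
theorem tendsto_smul_resolvent {r : ℝ → X} {z : X}
    (hr : ∀ᶠ c : ℝ in atTop, (r c, (c : 𝕜) • r c - z) ∈ T.generator.graph) :
    Tendsto (fun c : ℝ => (c : 𝕜) • r c) atTop (𝓝 z) := by
  obtain ⟨M, hM0, hM⟩ := T.exists_resolvent_bound
  rw [tendsto_iff_norm_sub_tendsto_zero, Metric.tendsto_nhds]
  intro ε hε
  obtain ⟨z', hz', hd⟩ := T.dense_generator_domain.exists_dist_lt z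
    -- The final estimate is `(M + 1) ‖z - z'‖ + M ‖y'‖ / c`.
    (show 0 < ε / (2 * (M + 1)) by positivity)
  set y' := T.generator ⟨z', hz'⟩ with hy'
  have hg : (z', y') ∈ T.generator.graph := T.generator.mem_graph ⟨z', hz'⟩
  have hsm : Tendsto (fun c : ℝ => M * (‖y'‖ / c)) atTop (𝓝 0) := by
    simpa using (tendsto_const_nhds.div_atTop tendsto_id).const_mul M
  filter_upwards [hr, hM, eventually_gt_atTop 0,
    hsm.eventually_lt_const (show 0 < ε / 2 by positivity)] with c hrc ⟨hb, _⟩ hc0 hcs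
  have hcK : (c : 𝕜) ≠ 0 := RCLike.ofReal_ne_zero.2 hc0.ne'
  -- Compare `r c` with `c⁻¹ z'`: applying `c - A` to their difference gives `(z - z') + c⁻¹ A z'`,
  -- and the bound `M / c` absorbs the factor `c`.
  have h1 := hb _ _ (T.generator.graph.sub_mem hrc (T.generator.graph.smul_mem (c : 𝕜)⁻¹ hg))
  have h2 : (c : 𝕜) • (r c - (c : 𝕜)⁻¹ • z') - ((c : 𝕜) • r c - z - (c : 𝕜)⁻¹ • y')
      = (z - z') + (c : 𝕜)⁻¹ • y' := by
    rw [smul_sub, smul_inv_smul₀ hcK]; abel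
  simp only [Prod.smul_mk] at h1
  rw [h2] at h1
  rw [dist_eq_norm] at hd
  have h3 : ‖(z - z') + (c : 𝕜)⁻¹ • y'‖ ≤ ‖z - z'‖ + ‖y'‖ / c := by
    refine (norm_add_le _ _).trans (le_of_eq ?_)
    rw [norm_smul, norm_inv, RCLike.norm_ofReal, abs_of_pos hc0]
    ring
  have h4 : ‖(c : 𝕜) • r c - z'‖ ≤ M * (‖z - z'‖ + ‖y'‖ / c) := by
    have h5 : (c : 𝕜) • r c - z' = (c : 𝕜) • (r c - (c : 𝕜)⁻¹ • z') := by
      rw [smul_sub, smul_inv_smul₀ hcK]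
    rw [h5, norm_smul, RCLike.norm_ofReal, abs_of_pos hc0]
    calc _ ≤ c * (M / c * (‖z - z'‖ + ‖y'‖ / c)) := by gcongr; exact h1.trans (by gcongr)
      _ = _ := by field_simp
  have h6 : ‖(c : 𝕜) • r c - z‖ ≤ ‖(c : 𝕜) • r c - z'‖ + ‖z - z'‖ := by
    calc _ = ‖((c : 𝕜) • r c - z') - (z - z')‖ := by congr 1; abel
      _ ≤ _ := norm_sub_le _ _
  rw [Real.dist_eq, sub_zero, abs_norm]
  have h7 : (M + 1) * ‖z - z'‖ < ε / 2 := by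
    calc _ < (M + 1) * (ε / (2 * (M + 1))) := by gcongr
      _ = _ := by field_simp
  linarith

end ResolventOperator

/-! ### Graph-norm approximation and the extrapolation space. -/

section Extrapolation

variable {𝕜 X : Type*} [RCLike 𝕜] [NormedAddCommGroup X] [InnerProductSpace 𝕜 X]

theorem _root_.DomainSpace.mem_graph {A : X →ₗ.[𝕜] X} (x : DomainSpace A) :
    (DomainSpace.incl A x, DomainSpace.op A x) ∈ A.graph := A.mem_graph x

theorem _root_.DomainSpace.norm_le {A : X →ₗ.[𝕜] X} (x : DomainSpace A) :
    ‖x‖ ≤ ‖DomainSpace.incl A x‖ + ‖DomainSpace.op A x‖ := by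
  refine le_of_sq_le_sq ?_ (by positivity)
  rw [DomainSpace.norm_sq_eq]
  nlinarith [norm_nonneg (DomainSpace.incl A x), norm_nonneg (DomainSpace.op A x)]

theorem _root_.DomainSpace.op_eq_of_mem_graph {A : X →ₗ.[𝕜] X} (x : DomainSpace A) {y : X}
    (h : (DomainSpace.incl A x, y) ∈ A.graph) : DomainSpace.op A x = y :=
  A.mem_graph_snd_inj (DomainSpace.mem_graph x) h rfl

theorem IsResolvent.mem_operatorResolventSet {T : C0Semigroup 𝕜 X} {c : ℝ} {R : X →L[𝕜] X}
    (h : T.IsResolvent c R) : (c : 𝕜) ∈ operatorResolventSet T.generator := by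
  have hR : ∀ x, R (shiftedOperator T.generator (c : 𝕜) x) = DomainSpace.incl _ x := fun x =>
    h.apply_sub _ _ (DomainSpace.mem_graph x)
  refine ⟨⟨fun x y hxy => ?_, fun z => ?_⟩, ‖R‖, fun x => ?_⟩
  · have h1 := hR x
    rw [hxy, hR y] at h1
    exact Subtype.ext h1.symm
  · refine ⟨DomainSpace.mk (R z) (T.mem_domain_of_mem_graph (h.mem_graph z)), ?_⟩
    show (c : 𝕜) • R z - DomainSpace.op _ _ = z
    rw [DomainSpace.op_eq_of_mem_graph _ (h.mem_graph z), sub_sub_cancel]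
  · rw [← hR x]
    exact R.le_opNorm _

theorem IsResolvent.incl_operatorResolvent {T : C0Semigroup 𝕜 X} {c : ℝ} {R : X →L[𝕜] X}
    (h : T.IsResolvent c R) (z : X) :
    DomainSpace.incl _ (operatorResolvent T.generator (c : 𝕜) z) = R z := by
  have h1 : shiftedOperator T.generator (c : 𝕜) (operatorResolvent T.generator (c : 𝕜) z) = z := by
    rw [operatorResolvent, dif_pos h.mem_operatorResolventSet]
    exact LinearEquiv.apply_symm_apply
      (LinearEquiv.ofBijective (shiftedOperator T.generator (c : 𝕜)) h.mem_operatorResolventSet.1) z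
  have h2 := h.apply_sub _ _
    (DomainSpace.mem_graph (operatorResolvent T.generator (c : 𝕜) z))
  rw [← h2]
  exact congrArg R h1

variable [NormedSpace ℝ X] [CompleteSpace X] (T : C0Semigroup 𝕜 X)
  {U : Type*} [NormedAddCommGroup U] [NormedSpace 𝕜 U]

/-- Convergence must be in the graph norm, the only one for which `C` is bounded. Since `A` commutes
with its resolvent, both graph components are instances of `c (c - A)⁻¹ z → z`. -/
theorem tendsto_smul_operatorResolvent (x : DomainSpace T.generator) :
    Tendsto (fun c : ℝ => (c : 𝕜) • operatorResolvent T.generator (c : 𝕜) (DomainSpace.incl _ x))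
      atTop (𝓝 x) := by
  set r : ℝ → X → X := fun c z =>
    DomainSpace.incl _ (operatorResolvent T.generator (c : 𝕜) z) with hr
  have hlim : ∀ z, Tendsto (fun c : ℝ => (c : 𝕜) • r c z) atTop (𝓝 z) := fun z => by
    refine T.tendsto_smul_resolvent ?_
    filter_upwards [T.eventually_exists_isResolvent] with c ⟨R, hR⟩
    rw [hr]
    simp only
    rw [hR.incl_operatorResolvent]
    exact hR.mem_graph z
  have h1 := ((hlim (DomainSpace.incl _ x)).sub_const (DomainSpace.incl _ x)).norm.add
    ((hlim (DomainSpace.op _ x)).sub_const (DomainSpace.op _ x)).norm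
  simp only [sub_self, norm_zero, add_zero] at h1
  rw [tendsto_iff_norm_sub_tendsto_zero]
  refine squeeze_zero' (Eventually.of_forall fun _ => norm_nonneg _) ?_ h1
  filter_upwards [T.eventually_exists_isResolvent] with c ⟨R, hR⟩
  refine (DomainSpace.norm_le _).trans (le_of_eq ?_)
  rw [_root_.map_sub, _root_.map_sub, _root_.map_smul, _root_.map_smul]
  congr 4
  have h2 := hR.mem_graph (DomainSpace.incl _ x)
  rw [← hR.incl_operatorResolvent] at h2
  rw [DomainSpace.op_eq_of_mem_graph _ h2]
  have h3 := hR.apply_sub _ _ (DomainSpace.mem_graph x)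
  rw [_root_.map_sub, _root_.map_smul] at h3
  simp only [hr]
  rw [hR.incl_operatorResolvent, hR.incl_operatorResolvent]
  rw [sub_eq_iff_eq_add] at h3
  rw [h3, add_sub_cancel_left]

/-- The `Λ`-extension of `C` is an extension of `C`. -/
theorem tendsto_lambda (C : DomainSpace T.generator →L[𝕜] U) (x : DomainSpace T.generator) :
    Tendsto (fun μ : ℝ => (C.toLinearMap ∘ₗ
      ((μ : 𝕜) • operatorResolvent T.generator (μ : 𝕜))) (DomainSpace.incl _ x)) atTop
      (𝓝 (C x)) :=
  (C.continuous.tendsto x).comp (T.tendsto_smul_operatorResolvent x)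

theorem mem_lambdaExtension_domain (C : DomainSpace T.generator →L[𝕜] U)
    (x : DomainSpace T.generator) :
    DomainSpace.incl _ x ∈ (lambdaExtension T.generator C).domain := ⟨_, T.tendsto_lambda C x⟩

theorem lambdaExtension_incl (C : DomainSpace T.generator →L[𝕜] U)
    (x : DomainSpace T.generator)
    (hx : DomainSpace.incl _ x ∈ (lambdaExtension T.generator C).domain) :
    lambdaExtension T.generator C ⟨DomainSpace.incl _ x, hx⟩ = C x :=
  limitOperator_apply_eq ⟨_, hx⟩ (T.tendsto_lambda C x)

/-- Vectors orthogonal to the graph of `A` have the form `(-A* y, y)`. The equation in `[D(A*)]'`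
thus says that `(x, z)` lies in the double orthogonal complement of the graph, which is the graph
itself because `A` is closed. -/
theorem extendedOperator_eq_pivotEmbedding_iff {x z : X} :
    extendedOperator T.generator x = pivotEmbedding T.generator z ↔
      (x, z) ∈ T.generator.graph := by
  set A := T.generator with hA
  have hd : Dense (A.domain : Set X) := T.dense_generator_domain
  constructor
  · intro h
    set K : Submodule 𝕜 (WithLp 2 (X × X)) :=
      A.graph.comap (WithLp.linearEquiv 2 𝕜 (X × X)).toLinearMap with hK
    have hKc : IsClosed (K : Set (WithLp 2 (X × X))) :=
      IsClosed.preimage (WithLp.prod_continuous_ofLp 2 X X) T.isClosed_generator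
    have : CompleteSpace K := hKc.completeSpace_coe
    have h1 : WithLp.toLp 2 (x, z) ∈ Kᗮᗮ := by
      rw [Submodule.mem_orthogonal]
      intro w hw
      rw [Submodule.mem_orthogonal] at hw
      have key : ∀ x : A.domain, ⟪-w.fst, (x : X)⟫_𝕜 = ⟪w.snd, A x⟫_𝕜 := by
        intro x
        have hx := hw (WithLp.toLp 2 ((x : X), A x)) (A.mem_graph x)
        rw [WithLp.prod_inner_apply] at hx
        have hx' := congrArg (starRingEnd 𝕜) hx
        simp only [_root_.map_add, inner_conj_symm, _root_.map_zero] at hx'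
        rw [inner_neg_left]
        exact neg_eq_of_add_eq_zero_right hx'
      have hmem : w.snd ∈ A.adjoint.domain := A.mem_adjoint_domain_of_exists _ ⟨_, key⟩
      have h0 : ⟪DomainSpace.op _ (DomainSpace.mk w.snd hmem), x⟫_𝕜 = ⟪w.snd, z⟫_𝕜 :=
        congrArg (fun f => f (DomainSpace.mk w.snd hmem)) h
      have h3 : DomainSpace.op _ (DomainSpace.mk w.snd hmem) = -w.fst :=
        LinearPMap.adjoint_apply_eq hd _ key
      rw [h3, inner_neg_left] at h0
      rw [WithLp.prod_inner_apply]
      show ⟪w.fst, x⟫_𝕜 + ⟪w.snd, z⟫_𝕜 = 0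
      rw [← h0, add_neg_cancel]
    rw [Submodule.orthogonal_orthogonal] at h1
    exact h1
  · intro h
    obtain ⟨x, rfl, rfl⟩ := (LinearPMap.mem_graph_iff _).1 h
    ext y
    exact LinearPMap.adjoint_isFormalAdjoint hd y x

omit [NormedSpace ℝ X] in
-- `D(A*)` is isometric to its graph in `X × X`: extend the functional by Hahn–Banach and represent
-- it by Riesz. This yields surjectivity of `c - Ã`.
theorem exists_pivotEmbedding_add_extendedOperator (A : X →ₗ.[𝕜] X) (f : ExtrapolationSpace A) :
    ∃ x z, f = pivotEmbedding A z + extendedOperator A x := by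
  set g := DomainSpace.toGraph A.adjoint
  set e := LinearEquiv.ofInjective g (DomainSpace.toGraph_injective A.adjoint)
  have he : ∀ p, ‖e.symm p‖ = ‖p‖ := fun p => by
    obtain ⟨y, rfl⟩ := e.surjective p
    rw [e.symm_apply_apply]
    rfl
  -- Functionals in `[D(A*)]'` are conjugate-linear, so conjugation produces the linear one needed
  -- for Riesz.
  let φ : LinearMap.range g →L[𝕜] 𝕜 := LinearMap.mkContinuous
    { toFun := fun p => starRingEnd 𝕜 (f (e.symm p))
      map_add' := fun p q => by simp
      map_smul' := fun c p => by simp } ‖f‖ fun p => by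
        rw [← he p]
        show ‖starRingEnd 𝕜 (f (e.symm p))‖ ≤ _
        rw [RCLike.norm_conj]
        exact f.le_opNorm _
  obtain ⟨ψ, hψ, -⟩ := exists_extension_norm_eq _ φ
  set v := (InnerProductSpace.toDual 𝕜 _).symm ψ with hv
  refine ⟨v.snd, v.fst, ?_⟩
  ext y
  have h1 : ⟪v, g y⟫_𝕜 = starRingEnd 𝕜 (f y) := by
    rw [hv, InnerProductSpace.toDual_symm_apply]
    refine (hψ (e y)).trans ?_
    show starRingEnd 𝕜 (f (e.symm (e y))) = _
    rw [e.symm_apply_apply]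
  have h2 := congrArg (starRingEnd 𝕜) h1
  rw [inner_conj_symm, RCLike.conj_conj] at h2
  rw [← h2, WithLp.prod_inner_apply]
  rfl

/-- `c - Ã` as an isomorphism of `X` onto `[D(A*)]'`. -/
theorem IsResolvent.exists_equiv {T : C0Semigroup 𝕜 X} {c : ℝ} {R : X →L[𝕜] X}
    (h : T.IsResolvent c R) : ∃ E : X ≃L[𝕜] ExtrapolationSpace T.generator,
      (∀ x, E x = (c : 𝕜) • pivotEmbedding T.generator x - extendedOperator T.generator x) ∧
      (∀ z, E (R z) = pivotEmbedding T.generator z) := by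
  set E₀ : X →L[𝕜] ExtrapolationSpace T.generator :=
    (c : 𝕜) • pivotEmbedding T.generator - extendedOperator T.generator with hE₀
  have hE : ∀ x, E₀ x = (c : 𝕜) • pivotEmbedding T.generator x - extendedOperator T.generator x :=
    fun _ => rfl
  have hR : ∀ z, E₀ (R z) = pivotEmbedding T.generator z := fun z => by
    rw [hE, T.extendedOperator_eq_pivotEmbedding_iff.2 (h.mem_graph z), _root_.map_sub,
      _root_.map_smul, sub_sub_cancel]
  have hker : E₀.ker = ⊥ := by
    rw [LinearMap.ker_eq_bot']
    intro x hx
    have h1 : extendedOperator T.generator x = pivotEmbedding T.generator ((c : 𝕜) • x) := by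
      rw [_root_.map_smul]
      exact (sub_eq_zero.1 hx).symm
    have h2 := h.apply_sub _ _ (T.extendedOperator_eq_pivotEmbedding_iff.1 h1)
    rw [← h2, sub_self, _root_.map_zero]
  have hran : E₀.range = ⊤ := by
    rw [LinearMap.range_eq_top]
    intro f
    obtain ⟨x, z, rfl⟩ := exists_pivotEmbedding_add_extendedOperator _ f
    -- `R z` is the preimage of `z`, and `c R x - x` that of `c x - (c x - Ã x) = Ã x`.
    refine ⟨R z + (c : 𝕜) • R x - x, ?_⟩
    show E₀ _ = _
    rw [_root_.map_sub, _root_.map_add, _root_.map_smul, hR, hR, hE]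
    abel
  exact ⟨ContinuousLinearEquiv.ofBijective E₀ hker hran, hE, hR⟩

omit [NormedSpace ℝ X] in
theorem extended_extendedOperator (t : ℝ≥0) (x : X) :
    T.extended t (extendedOperator T.generator x)
      = extendedOperator T.generator (T.toFun t x) := by
  ext y
  have h : DomainSpace.op _ (T.adjointOnDomain t y) = (T.toFun t).adjoint (DomainSpace.op _ y) :=
    T.adjoint_generator_map t y
  rw [extended_apply, extendedOperator_apply, extendedOperator_apply, h,
    ContinuousLinearMap.adjoint_inner_left]

end Extrapolation

end C0Semigroup

/-- If the range of `W` is contained in the range of an injective `R`, then `W` factors through `R`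
by a bounded operator. -/
theorem ContinuousLinearMap.exists_comp_eq_of_injective {𝕜 E F G : Type*}
    [NontriviallyNormedField 𝕜] [NormedAddCommGroup E] [NormedSpace 𝕜 E] [CompleteSpace E]
    [NormedAddCommGroup F] [NormedSpace 𝕜 F] [CompleteSpace F]
    [NormedAddCommGroup G] [NormedSpace 𝕜 G] (W : E →L[𝕜] G) (R : F →L[𝕜] G)
    (hR : Function.Injective R) (h : ∀ u, ∃ z, R z = W u) :
    ∃ Φ : E →L[𝕜] F, ∀ u, R (Φ u) = W u := by
  choose φ hφ using h
  let L : E →ₗ[𝕜] F :=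
    { toFun := φ
      map_add' := fun u v => hR (by simp only [map_add, hφ])
      map_smul' := fun a u => hR (by simp only [map_smul, hφ, RingHom.id_apply]) }
  -- Injectivity of `R` turns the graph of the algebraic factor into the closed set `W u = R z`,
  -- ready for the closed graph theorem.
  have hL : (L.graph : Set (E × F)) = {p | W p.1 = R p.2} := by
    ext ⟨u, z⟩
    simp only [SetLike.mem_coe, LinearMap.mem_graph_iff, Set.mem_ofPred_eq]
    constructor
    · rintro rfl
      exact (hφ u).symm
    · intro hz
      exact hR (hz.symm.trans (hφ u).symm)
  have hcl : IsClosed (L.graph : Set (E × F)) := by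
    rw [hL]
    exact isClosed_eq (by fun_prop) (by fun_prop)
  exact ⟨⟨L, L.continuous_of_isClosed_graph hcl⟩, hφ⟩

namespace C0Semigroup

/-! ### The control side: input integrals moved into `X`. -/

section Convolution

variable {𝕜 X U : Type*} [RCLike 𝕜] [NormedAddCommGroup X] [NormedSpace 𝕜 X]
  [NormedSpace ℝ X] [CompleteSpace X]
  [NormedAddCommGroup U] [NormedSpace 𝕜 U] (T : C0Semigroup 𝕜 X) (b : U →L[𝕜] X)

omit [NormedSpace ℝ X] in
theorem integrable_convolution (τ : ℝ) {v : ℝ → U}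
    (hv : Integrable v (volume.restrict (Set.Ioc 0 τ))) :
    Integrable (fun s : ℝ => T.toFun s.toNNReal (b (v s))) (volume.restrict (Set.Ioc 0 τ)) := by
  obtain ⟨M, hM0, hM⟩ := T.exists_norm_le τ.toNNReal
  refine Integrable.mono' (hv.norm.const_mul (M * ‖b‖)) ?_ ?_
  · refine T.continuous_uncurry.comp_aestronglyMeasurable
      (f := fun s : ℝ => (s.toNNReal, b (v s))) (AEStronglyMeasurable.prodMk ?_ ?_)
    · exact continuous_real_toNNReal.aestronglyMeasurable
    · exact b.continuous.comp_aestronglyMeasurable hv.aestronglyMeasurable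
  · filter_upwards [ae_restrict_mem measurableSet_Ioc] with s hs
    have h1 := (T.toFun s.toNNReal).le_of_opNorm_le (hM _ (Real.toNNReal_mono hs.2)) (b (v s))
    refine h1.trans ?_
    rw [mul_assoc]
    exact mul_le_mul_of_nonneg_left (b.le_opNorm _) hM0.le

/-- The bounded operator `v ↦ ∫₀^τ T(s) b v(s) ds` on `L²(0, τ; U)`. -/
theorem exists_convolution_clm (τ : ℝ) :
    ∃ W : Lp U 2 (volume.restrict (Set.Ioc 0 τ)) →L[𝕜] X,
      ∀ v, W v = ∫ s in Set.Ioc 0 τ, T.toFun s.toNNReal (b (v s)) := by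
  obtain ⟨M, hM0, hM⟩ := T.exists_norm_le τ.toNNReal
  set μ := volume.restrict (Set.Ioc 0 τ) with hμ
  have hint : ∀ v : Lp U 2 μ, Integrable v μ := fun v => (Lp.memLp v).integrable (by norm_num)
  -- The Hölder constant of the embedding `L² ⊂ L¹` on a bounded interval.
  set k : ℝ≥0∞ := μ Set.univ ^ (1 / (1 : ℝ≥0∞).toReal - 1 / (2 : ℝ≥0∞).toReal) with hk
  have hkt : k ≠ ∞ := by
    refine ENNReal.rpow_ne_top_of_nonneg (by norm_num) (measure_ne_top _ _)
  refine ⟨LinearMap.mkContinuous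
    { toFun := fun v => ∫ s in Set.Ioc 0 τ, T.toFun s.toNNReal (b (v s))
      map_add' := fun v w => ?_
      map_smul' := fun a v => ?_ } (M * ‖b‖ * k.toReal) fun v => ?_, fun v => rfl⟩
  · rw [← integral_add (T.integrable_convolution b τ (hint v))
      (T.integrable_convolution b τ (hint w))]
    refine integral_congr_ae ?_
    filter_upwards [Lp.coeFn_add v w] with s hs
    simp only [hs, Pi.add_apply, _root_.map_add]
  · rw [RingHom.id_apply, ← integral_smul]
    refine integral_congr_ae ?_
    filter_upwards [Lp.coeFn_smul a v] with s hs
    simp only [hs, Pi.smul_apply, _root_.map_smul]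
  · have h1 : ‖∫ s in Set.Ioc 0 τ, T.toFun s.toNNReal (b (v s))‖ ≤ ∫ s, M * ‖b‖ * ‖v s‖ ∂μ := by
      refine norm_integral_le_of_norm_le ((hint v).norm.const_mul _) ?_
      filter_upwards [ae_restrict_mem measurableSet_Ioc] with s hs
      refine ((T.toFun s.toNNReal).le_of_opNorm_le (hM _ (Real.toNNReal_mono hs.2))
        (b (v s))).trans ?_
      rw [mul_assoc]
      exact mul_le_mul_of_nonneg_left (b.le_opNorm _) hM0.le
    have h2 : ∫ s, ‖v s‖ ∂μ ≤ k.toReal * ‖v‖ := by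
      rw [integral_norm_eq_lintegral_enorm (hint v).aestronglyMeasurable,
        ← eLpNorm_one_eq_lintegral_enorm, Lp.norm_def, mul_comm, ← ENNReal.toReal_mul]
      refine ENNReal.toReal_mono (ENNReal.mul_ne_top (Lp.eLpNorm_ne_top v) hkt) ?_
      exact eLpNorm_le_eLpNorm_mul_rpow_measure_univ (by norm_num)
        (hint v).aestronglyMeasurable
    rw [integral_const_mul] at h1
    refine h1.trans ?_
    rw [mul_assoc (M * ‖b‖)]
    gcongr

end Convolution

section Control

variable {𝕜 X U : Type*} [RCLike 𝕜] [NormedAddCommGroup X] [InnerProductSpace 𝕜 X]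
  [NormedSpace ℝ X] [CompleteSpace X]
  [NormedAddCommGroup U] [NormedSpace 𝕜 U] [CompleteSpace U] {T : C0Semigroup 𝕜 X}

/-- With `b = (c - Ã)⁻¹ B` and `R = (c - A)⁻¹`, an admissible control operator has the property
that `R⁻¹ ∫₀ᵗ T(s) b v(s) ds` is bounded by the `L²`-norm of `v`, uniformly for small `t`. -/
theorem AdmissibleControl.exists_bound {B : U →L[𝕜] ExtrapolationSpace T.generator}
    (hB : T.AdmissibleControl B) {c : ℝ} {R : X →L[𝕜] X} (hR : T.IsResolvent c R)
    {b : U →L[𝕜] X} (hb : ∀ u, B u = (c : 𝕜) • pivotEmbedding T.generator (b u)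
      - extendedOperator T.generator (b u)) :
    ∃ τ > (0 : ℝ), ∃ K > (0 : ℝ), ∀ t ≤ τ, ∀ v : ℝ → U,
      MemLp v 2 (volume.restrict (Set.Ioc 0 t)) →
      ∃ z, R z = ∫ s in Set.Ioc 0 t, T.toFun s.toNNReal (b (v s)) ∧
        ‖z‖ ≤ K * (eLpNorm v 2 (volume.restrict (Set.Ioc 0 t))).toReal := by
  obtain ⟨τ, hτ, h⟩ := hB
  obtain ⟨E, hE, hER⟩ := hR.exists_equiv
  obtain ⟨W, hW⟩ := T.exists_convolution_clm b τ
  have hEb : ∀ (t : ℝ≥0) u, T.extended t (B u) = E (T.toFun t (b u)) := fun t u => by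
    rw [hb, _root_.map_sub, _root_.map_smul, extended_pivotEmbedding, extended_extendedOperator,
      hE]
  -- Applying `E = c - Ã` to `W v` gives an input integral of `B`, which admissibility places in
  -- `X`, that is, in `E` of the range of `R`.
  obtain ⟨Φ, hΦ⟩ := W.exists_comp_eq_of_injective R hR.injective fun v => by
    -- Inputs are extended by zero and reversed in time, as `inputMap` weights `u(s)` by the
    -- semigroup at `τ - s` and `W` at `s`.
    set v' : ℝ → U := (Set.Ioc 0 τ).indicator v with hv'
    have h1 : MemLp v' 2 volume := (memLp_indicator_iff_restrict measurableSet_Ioc).2 (Lp.memLp v)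
    have h2 : MemLp (fun s => v' (τ - s)) 2 volume :=
      h1.comp_measurePreserving (Measure.measurePreserving_sub_left volume τ)
    obtain ⟨x, hx⟩ := h _ (h2.restrict _)
    refine ⟨x, E.injective ?_⟩
    rw [hER, hx, inputMap,
      intervalIntegral.integral_comp_sub_left (fun r => T.extended r.toNNReal (B (v' r))) τ,
      sub_self, sub_zero, intervalIntegral.integral_of_le hτ.le, hW, ← E.integral_comp_comm]
    refine setIntegral_congr_fun measurableSet_Ioc fun s hs => ?_
    simp only [hEb, hv', Set.indicator_of_mem hs]
  refine ⟨τ, hτ, ‖Φ‖ + 1, by positivity, fun t ht v hv => ?_⟩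
  have hsub : Set.Ioc 0 t ⊆ Set.Ioc 0 τ := Set.Ioc_subset_Ioc_right ht
  have hres : (volume.restrict (Set.Ioc 0 τ)).restrict (Set.Ioc 0 t)
      = volume.restrict (Set.Ioc 0 t) := by
    rw [Measure.restrict_restrict measurableSet_Ioc, Set.inter_eq_self_of_subset_left hsub]
  -- In the form `T(s) b v(s)`, extending `v` by zero from `(0, t]` to `(0, τ]` leaves the integral
  -- unchanged, so one `Φ` serves all `t ≤ τ`.
  have h1 : MemLp ((Set.Ioc 0 t).indicator v) 2 (volume.restrict (Set.Ioc 0 τ)) := by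
    rw [memLp_indicator_iff_restrict measurableSet_Ioc, hres]
    exact hv
  refine ⟨Φ (MemLp.toLp _ h1), ?_, ?_⟩
  · rw [hΦ, hW]
    have h2 : ∫ s in Set.Ioc 0 τ, T.toFun s.toNNReal (b ((MemLp.toLp _ h1 : Lp U 2 _) s))
        = ∫ s in Set.Ioc 0 τ,
          (Set.Ioc 0 t).indicator (fun s => T.toFun s.toNNReal (b (v s))) s := by
      refine integral_congr_ae ?_
      filter_upwards [h1.coeFn_toLp] with s hs
      rw [hs]
      by_cases hst : s ∈ Set.Ioc 0 t
      · simp only [Set.indicator_of_mem hst]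
      · simp only [Set.indicator_of_notMem hst, _root_.map_zero]
    rw [h2, integral_indicator measurableSet_Ioc, hres]
  · refine (Φ.le_opNorm _).trans ?_
    rw [Lp.norm_toLp, eLpNorm_indicator_eq_eLpNorm_restrict measurableSet_Ioc, hres]
    gcongr
    linarith

end Control

/-! ### The observation side: outputs of orbits in `D(A)`. -/

section OnDomain

variable {𝕜 X U : Type*} [RCLike 𝕜] [NormedAddCommGroup X] [InnerProductSpace 𝕜 X]
  [NormedAddCommGroup U] [NormedSpace 𝕜 U] (T : C0Semigroup 𝕜 X)

theorem incl_onDomain (t : ℝ≥0) (x : DomainSpace T.generator) :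
    DomainSpace.incl _ (T.onDomain t x) = T.toFun t (DomainSpace.incl _ x) := rfl

theorem op_onDomain (t : ℝ≥0) (x : DomainSpace T.generator) :
    DomainSpace.op _ (T.onDomain t x) = T.toFun t (DomainSpace.op _ x) := T.generator_map t x

theorem _root_.DomainSpace.incl_injective {A : X →ₗ.[𝕜] X} : Function.Injective (DomainSpace.incl A) :=
  fun _ _ h => Subtype.ext h

theorem onDomain_zero (x : DomainSpace T.generator) : T.onDomain 0 x = x :=
  DomainSpace.incl_injective (T.map_zero_apply _)

theorem onDomain_add (s t : ℝ≥0) (x : DomainSpace T.generator) :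
    T.onDomain (s + t) x = T.onDomain s (T.onDomain t x) :=
  DomainSpace.incl_injective (T.map_add_apply s t _)

theorem onDomain_map_add (t : ℝ≥0) (x y : DomainSpace T.generator) :
    T.onDomain t (x + y) = T.onDomain t x + T.onDomain t y :=
  DomainSpace.incl_injective ((T.toFun t).map_add _ _)

theorem onDomain_map_smul (t : ℝ≥0) (a : 𝕜) (x : DomainSpace T.generator) :
    T.onDomain t (a • x) = a • T.onDomain t x :=
  DomainSpace.incl_injective ((T.toFun t).map_smul _ _)

variable [CompleteSpace X]

theorem continuous_onDomain (x : DomainSpace T.generator) :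
    Continuous fun t => T.onDomain t x := by
  rw [continuous_iff_continuousAt]
  intro t
  have h1 := (((T.continuous_apply (DomainSpace.incl _ x)).tendsto t).sub_const
    (T.toFun t (DomainSpace.incl _ x))).norm.add
    (((T.continuous_apply (DomainSpace.op _ x)).tendsto t).sub_const
    (T.toFun t (DomainSpace.op _ x))).norm
  simp only [sub_self, norm_zero, add_zero] at h1
  rw [ContinuousAt, tendsto_iff_norm_sub_tendsto_zero]
  refine squeeze_zero (fun _ => norm_nonneg _) (fun s => ?_) h1
  refine (DomainSpace.norm_le _).trans (le_of_eq ?_)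
  rw [_root_.map_sub, _root_.map_sub, incl_onDomain, incl_onDomain, op_onDomain, op_onDomain]

theorem continuous_output (C : DomainSpace T.generator →L[𝕜] U) (t : ℝ)
    (x : DomainSpace T.generator) :
    Continuous fun s : ℝ => C (T.onDomain (t - s).toNNReal x) :=
  C.continuous.comp ((T.continuous_onDomain x).comp
    (continuous_real_toNNReal.comp (by fun_prop)))

omit [CompleteSpace X] in
-- The observation estimate survives the time reversal `s ↦ t - s`, which preserves Lebesgue
-- measure; the convolution feeds the output in reversed.
theorem eLpNorm_output_le (C : DomainSpace T.generator →L[𝕜] U) {τ : ℝ} {K : ℝ≥0}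
    (x : DomainSpace T.generator)
    (hK : ∫⁻ s in Set.Ioc 0 τ, ‖C (T.onDomain s.toNNReal x)‖ₑ ^ 2
      ≤ K * ‖DomainSpace.incl _ x‖ₑ ^ 2) {t : ℝ} (ht : t ≤ τ) :
    (eLpNorm (fun s : ℝ => C (T.onDomain (t - s).toNNReal x)) 2
      (volume.restrict (Set.Ioc 0 t))).toReal ≤ √K * ‖DomainSpace.incl _ x‖ := by
  set f : ℝ → ℝ≥0∞ := fun s => ‖C (T.onDomain s.toNNReal x)‖ₑ ^ 2 with hf
  have h1 : ∫⁻ s in Set.Ioc 0 t, f (t - s) ≤ ∫⁻ s in Set.Ioc 0 τ, f s := by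
    have h2 : ∫⁻ s in Set.Ioc 0 t, f (t - s) = ∫⁻ s in Set.Ico 0 t, f s := by
      rw [← lintegral_indicator measurableSet_Ioc, ← lintegral_indicator measurableSet_Ico,
        ← lintegral_sub_left_eq_self ((Set.Ico 0 t).indicator f) t]
      congr 1
      funext s
      have : s ∈ Set.Ioc 0 t ↔ t - s ∈ Set.Ico 0 t := by
        simp only [Set.mem_Ioc, Set.mem_Ico, sub_nonneg, sub_lt_self_iff, and_comm]
      by_cases hs : s ∈ Set.Ioc 0 t
      · rw [Set.indicator_of_mem hs, Set.indicator_of_mem (this.1 hs)]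
      · rw [Set.indicator_of_notMem hs, Set.indicator_of_notMem (fun h => hs (this.2 h))]
    rw [h2, Measure.restrict_congr_set Ico_ae_eq_Ioc]
    exact lintegral_mono_set (Set.Ioc_subset_Ioc_right ht)
  have h3 := h1.trans hK
  have h4 : eLpNorm (fun s : ℝ => C (T.onDomain (t - s).toNNReal x)) 2
      (volume.restrict (Set.Ioc 0 t)) ≤ ENNReal.ofReal (√K * ‖DomainSpace.incl _ x‖) := by
    rw [eLpNorm_eq_lintegral_rpow_enorm_toReal (by norm_num) (by norm_num)]
    have h5 : ENNReal.ofReal (√K * ‖DomainSpace.incl _ x‖)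
        = ((K : ℝ≥0∞) * ‖DomainSpace.incl _ x‖ₑ ^ 2) ^ (1 / (2 : ℝ≥0∞).toReal) := by
      have h6 : (K : ℝ≥0∞) * ‖DomainSpace.incl _ x‖ₑ ^ 2
          = ENNReal.ofReal (√K * ‖DomainSpace.incl _ x‖) ^ (2 : ℝ) := by
        rw [ENNReal.rpow_two, ← ENNReal.ofReal_pow (by positivity), mul_pow,
          Real.sq_sqrt K.coe_nonneg, ENNReal.ofReal_mul K.coe_nonneg, ENNReal.ofReal_coe_nnreal,
          ENNReal.ofReal_pow (norm_nonneg _), ofReal_norm]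
      rw [h6, ← ENNReal.rpow_mul]
      norm_num
    rw [h5]
    gcongr
    simpa [hf] using h3
  refine (ENNReal.toReal_mono ENNReal.ofReal_ne_top h4).trans (le_of_eq ?_)
  exact ENNReal.toReal_ofReal (by positivity)

end OnDomain

/-! ### Construction of the corner operators `S(t)`. -/

section Cascade

variable {𝕜 X₁ X₂ U : Type*} [RCLike 𝕜] [NormedAddCommGroup X₁] [NormedSpace 𝕜 X₁]
  [NormedSpace ℝ X₁] [CompleteSpace X₁]
  [NormedAddCommGroup X₂] [InnerProductSpace 𝕜 X₂] [NormedSpace ℝ X₂] [CompleteSpace X₂]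
  [NormedAddCommGroup U] [NormedSpace 𝕜 U] (T₁ : C0Semigroup 𝕜 X₁) (T₂ : C0Semigroup 𝕜 X₂)
  (b : U →L[𝕜] X₁) (C : DomainSpace T₂.generator →L[𝕜] U)

/-- `∫₀ᵗ T₁(s) b C T₂(t - s) x ds` for `x ∈ D(A₂)`. -/
noncomputable def cascadeIntegral (t : ℝ) (x : DomainSpace T₂.generator) : X₁ :=
  ∫ s in (0 : ℝ)..t, T₁.toFun s.toNNReal (b (C (T₂.onDomain (t - s).toNNReal x)))

omit [NormedSpace ℝ X₁] [NormedSpace ℝ X₂] in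
theorem continuous_cascadeIntegrand (t : ℝ) (x : DomainSpace T₂.generator) :
    Continuous fun s : ℝ => T₁.toFun s.toNNReal (b (C (T₂.onDomain (t - s).toNNReal x))) :=
  T₁.continuous_uncurry.comp
    (continuous_real_toNNReal.prodMk (b.continuous.comp (T₂.continuous_output C t x)))

omit [NormedSpace ℝ X₂] in
theorem cascadeIntegral_map_add (t : ℝ) (x y : DomainSpace T₂.generator) :
    T₁.cascadeIntegral T₂ b C t (x + y)
      = T₁.cascadeIntegral T₂ b C t x + T₁.cascadeIntegral T₂ b C t y := by
  simp only [cascadeIntegral, onDomain_map_add, _root_.map_add]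
  exact intervalIntegral.integral_add
    ((T₁.continuous_cascadeIntegrand T₂ b C t x).intervalIntegrable _ _)
    ((T₁.continuous_cascadeIntegrand T₂ b C t y).intervalIntegrable _ _)

omit [CompleteSpace X₁] [NormedSpace ℝ X₂] [CompleteSpace X₂] in
theorem cascadeIntegral_map_smul (t : ℝ) (a : 𝕜) (x : DomainSpace T₂.generator) :
    T₁.cascadeIntegral T₂ b C t (a • x) = a • T₁.cascadeIntegral T₂ b C t x := by
  simp only [cascadeIntegral, onDomain_map_smul, _root_.map_smul]
  exact intervalIntegral.integral_smul a _

omit [NormedSpace ℝ X₂] in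
-- Split at `s`: before `s` the orbit of `T₂` has passed through time `t`, and after `s` a factor
-- `T₁(s)` comes out.
theorem cascadeIntegral_add (s t : ℝ≥0) (x : DomainSpace T₂.generator) :
    T₁.cascadeIntegral T₂ b C (s + t) x
      = T₁.toFun s (T₁.cascadeIntegral T₂ b C t x)
        + T₁.cascadeIntegral T₂ b C s (T₂.onDomain t x) := by
  have hi := fun a a' => (T₁.continuous_cascadeIntegrand T₂ b C ((s : ℝ) + t) x).intervalIntegrable
    (μ := volume) a a'
  rw [cascadeIntegral, ← intervalIntegral.integral_add_adjacent_intervals (hi 0 s) (hi s (s + t)),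
    add_comm]
  congr 1
  · rw [cascadeIntegral, ← ContinuousLinearMap.intervalIntegral_comp_comm _
      ((T₁.continuous_cascadeIntegrand T₂ b C t x).intervalIntegrable _ _)]
    have := intervalIntegral.integral_comp_add_right (a := 0) (b := (t : ℝ))
      (fun r : ℝ => T₁.toFun r.toNNReal (b (C (T₂.onDomain ((s : ℝ) + t - r).toNNReal x)))) (s : ℝ)
    rw [zero_add, add_comm (t : ℝ) s] at this
    rw [← this]
    refine intervalIntegral.integral_congr fun r hr => ?_
    rw [Set.uIcc_of_le t.coe_nonneg] at hr
    rw [← T₁.map_add_apply, Real.toNNReal_add hr.1 s.coe_nonneg, Real.toNNReal_coe,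
      add_comm s r.toNNReal, show (s : ℝ) + t - (r + s) = t - r by ring]
  · rw [cascadeIntegral]
    refine intervalIntegral.integral_congr fun r hr => ?_
    rw [Set.uIcc_of_le s.coe_nonneg] at hr
    rw [← T₂.onDomain_add, add_sub_right_comm,
      Real.toNNReal_add (sub_nonneg.2 hr.2) t.coe_nonneg, Real.toNNReal_coe]

omit [NormedSpace ℝ X₂] in
-- The off-diagonal entry of the generator, seen after `R`. On `D(A₂)` the integrand is jointly
-- continuous in both times, hence uniformly close to `b (C x)` for small `t`.
theorem tendsto_cascadeIntegral_div (x : DomainSpace T₂.generator) :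
    Tendsto (fun t : ℝ≥0 => ((t : ℝ) : 𝕜)⁻¹ • T₁.cascadeIntegral T₂ b C t x) (𝓝[>] 0)
      (𝓝 (b (C x))) := by
  have hc : Continuous fun p : ℝ≥0 × ℝ≥0 => T₁.toFun p.1 (b (C (T₂.onDomain p.2 x))) :=
    T₁.continuous_uncurry.comp (continuous_fst.prodMk (b.continuous.comp (C.continuous.comp
      ((T₂.continuous_onDomain x).comp continuous_snd))))
  rw [Metric.tendsto_nhds]
  intro ε hε
  have h0 := Metric.tendsto_nhds.1 (hc.tendsto (0, 0)) (ε / 2) (by positivity)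
  rw [T₁.map_zero_apply, T₂.onDomain_zero, nhds_prod_eq] at h0
  obtain ⟨p, hp, q, hq, hpq⟩ := eventually_prod_iff.1 h0
  obtain ⟨δ, hδ, hball⟩ := Metric.eventually_nhds_iff.1 (hp.and hq)
  have hev : ∀ᶠ t : ℝ≥0 in 𝓝[>] 0, t < δ.toNNReal :=
    nhdsWithin_le_nhds (Iio_mem_nhds (Real.toNNReal_pos.2 hδ))
  filter_upwards [hev, self_mem_nhdsWithin] with t ht ht0
  have ht0' : (0 : ℝ) < t := ht0
  have htd : (t : ℝ) < δ := Real.lt_toNNReal_iff_coe_lt.1 ht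
  have hin : ∀ r : ℝ, 0 ≤ r → r ≤ t → p r.toNNReal ∧ q r.toNNReal := fun r hr0 hr => by
    refine hball ?_
    rw [NNReal.dist_eq, Real.coe_toNNReal _ hr0, NNReal.coe_zero, sub_zero, abs_of_nonneg hr0]
    exact hr.trans_lt htd
  have h1 := intervalIntegral.norm_integral_le_of_norm_le_const (a := 0) (b := (t : ℝ))
    (C := ε / 2)
    (f := fun s => T₁.toFun s.toNNReal (b (C (T₂.onDomain ((t : ℝ) - s).toNNReal x))) - b (C x))
    fun s hs => by
      rw [Set.uIoc_of_le t.coe_nonneg] at hs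
      rw [← dist_eq_norm]
      exact (hpq (hin s hs.1.le hs.2).1
        (hin (t - s) (sub_nonneg.2 hs.2) (by linarith [hs.1])).2).le
  rw [intervalIntegral.integral_sub
    ((T₁.continuous_cascadeIntegrand T₂ b C t x).intervalIntegrable _ _)
    intervalIntegrable_const, intervalIntegral.integral_const, sub_zero,
    abs_of_nonneg t.coe_nonneg] at h1
  change ‖T₁.cascadeIntegral T₂ b C t x - (t : ℝ) • b (C x)‖ ≤ _ at h1
  rw [dist_eq_norm]
  have h2 : ((t : ℝ) : 𝕜)⁻¹ • T₁.cascadeIntegral T₂ b C t x - b (C x)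
      = (t : ℝ)⁻¹ • (T₁.cascadeIntegral T₂ b C t x - (t : ℝ) • b (C x)) := by
    rw [smul_sub, inv_smul_smul₀ ht0'.ne', ← RCLike.ofReal_inv, ← RCLike.real_smul_eq_coe_smul]
  rw [h2, norm_smul, norm_inv, Real.norm_of_nonneg t.coe_nonneg]
  calc (t : ℝ)⁻¹ * _ ≤ (t : ℝ)⁻¹ * (ε / 2 * t) := by gcongr
    _ = ε / 2 := by field_simp
    _ < ε := by linarith

variable {T₁ T₂ b C} {c : ℝ} {R : X₁ →L[𝕜] X₁}

omit [NormedSpace ℝ X₁] [CompleteSpace X₁] in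
theorem eq_of_forall_incl (hR : T₁.IsResolvent c R) {S S' : X₂ →L[𝕜] X₁}
    (h : ∀ x : DomainSpace T₂.generator,
      R (S (DomainSpace.incl _ x)) = R (S' (DomainSpace.incl _ x))) : S = S' := by
  refine ContinuousLinearMap.ext fun x => ?_
  refine congrFun (Continuous.ext_on T₂.dense_generator_domain S.continuous S'.continuous ?_) x
  intro y hy
  exact hR.injective (h (DomainSpace.mk y hy))

/-- The solution operators `S(t)` with `(c - A₁)⁻¹ S(t) x = ∫₀ᵗ T₁(s) b C T₂(t - s) x ds`. -/
theorem exists_cascade_operators (hR : T₁.IsResolvent c R) {τ K : ℝ} (hτ : 0 < τ) (hK : 0 < K)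
    (hin : ∀ t ≤ τ, ∀ v : ℝ → U, MemLp v 2 (volume.restrict (Set.Ioc 0 t)) →
      ∃ z, R z = ∫ s in Set.Ioc 0 t, T₁.toFun s.toNNReal (b (v s)) ∧
        ‖z‖ ≤ K * (eLpNorm v 2 (volume.restrict (Set.Ioc 0 t))).toReal)
    (hout : T₂.AdmissibleObservation C) :
    ∃ S : ℝ≥0 → X₂ →L[𝕜] X₁,
      (∀ t x, R (S t (DomainSpace.incl _ x)) = T₁.cascadeIntegral T₂ b C t x) ∧
      S 0 = 0 ∧
      (∀ s t, S (s + t) = (T₁.toFun s).comp (S t) + (S s).comp (T₂.toFun t)) ∧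
      ∀ x, Tendsto (fun t => S t x) (𝓝[>] 0) (𝓝 0) := by
  obtain ⟨τ', hτ', K', hK'⟩ := hout
  -- On `[0, σ]` both admissibility estimates are available.
  obtain ⟨σ, hσ, hστ⟩ : ∃ σ : ℝ≥0, 0 < σ ∧ (σ : ℝ) ≤ τ ∧ (σ : ℝ) ≤ τ' := by
    refine ⟨(min τ τ').toNNReal, Real.toNNReal_pos.2 (lt_min hτ hτ'), ?_⟩
    rw [Real.coe_toNNReal _ (lt_min hτ hτ').le]
    exact ⟨min_le_left _ _, min_le_right _ _⟩
  have hv : ∀ (t : ℝ≥0) (x : DomainSpace T₂.generator), ∃ m, ∀ s ∈ Set.Ioc (0 : ℝ) t,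
      ‖C (T₂.onDomain ((t : ℝ) - s).toNNReal x)‖ ≤ m := fun t x => by
    obtain ⟨m, hm⟩ := isCompact_Icc.exists_bound_of_continuousOn (s := Set.Icc (0 : ℝ) t)
      (T₂.continuous_output C t x).continuousOn
    exact ⟨m, fun s hs => hm s (Set.Ioc_subset_Icc_self hs)⟩
  have hmem : ∀ (t : ℝ≥0) (x : DomainSpace T₂.generator),
      MemLp (fun s : ℝ => C (T₂.onDomain ((t : ℝ) - s).toNNReal x)) 2
        (volume.restrict (Set.Ioc 0 (t : ℝ))) := fun t x => by
    obtain ⟨m, hm⟩ := hv t x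
    exact MemLp.of_bound (T₂.continuous_output C t x).aestronglyMeasurable m
      ((ae_restrict_mem measurableSet_Ioc).mono hm)
  have hint : ∀ (t : ℝ≥0) (x : DomainSpace T₂.generator), T₁.cascadeIntegral T₂ b C t x
      = ∫ s in Set.Ioc 0 (t : ℝ),
        T₁.toFun s.toNNReal (b (C (T₂.onDomain ((t : ℝ) - s).toNNReal x))) := fun t x =>
    intervalIntegral.integral_of_le t.coe_nonneg
  -- The two estimates compose to the bound `K √K'` on the dense `D(A₂)`, which permits extension to
  -- `X₂`.
  have hsmall : ∀ t ≤ σ, ∃ S : X₂ →L[𝕜] X₁,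
      ∀ x, R (S (DomainSpace.incl _ x)) = T₁.cascadeIntegral T₂ b C t x := by
    intro t ht
    have htτ : (t : ℝ) ≤ τ := (NNReal.coe_le_coe.2 ht).trans hστ.1
    have htτ' : (t : ℝ) ≤ τ' := (NNReal.coe_le_coe.2 ht).trans hστ.2
    choose z hz hzb using fun x => hin t htτ _ (hmem t x)
    simp only [← hint] at hz
    let L : DomainSpace T₂.generator →ₗ[𝕜] X₁ :=
      { toFun := z
        map_add' := fun x y => hR.injective (by
          rw [_root_.map_add, hz, hz, hz, cascadeIntegral_map_add])
        map_smul' := fun a x => hR.injective (by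
          rw [_root_.map_smul, hz, hz, cascadeIntegral_map_smul, RingHom.id_apply]) }
    have hdr : DenseRange (DomainSpace.incl T₂.generator) := by
      have := T₂.dense_generator_domain
      rwa [← Subtype.range_coe (s := (T₂.generator.domain : Set X₂))] at this
    refine ⟨L.extendOfNorm (DomainSpace.incl T₂.generator), fun x => ?_⟩
    rw [LinearMap.extendOfNorm_eq hdr ⟨K * √K', fun x => ?_⟩]
    · exact hz x
    · refine (hzb x).trans ?_
      rw [mul_assoc]
      exact mul_le_mul_of_nonneg_left (T₂.eLpNorm_output_le C x (hK' x) htτ') hK.le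
  have hadd : ∀ {s t : ℝ≥0} {S S' : X₂ →L[𝕜] X₁},
      (∀ x, R (S (DomainSpace.incl _ x)) = T₁.cascadeIntegral T₂ b C s x) →
      (∀ x, R (S' (DomainSpace.incl _ x)) = T₁.cascadeIntegral T₂ b C t x) →
      ∀ x, R (((T₁.toFun s).comp S' + S.comp (T₂.toFun t)) (DomainSpace.incl _ x))
        = T₁.cascadeIntegral T₂ b C (s + t) x := by
    intro s t S S' hS hS' x
    rw [cascadeIntegral_add, ← hS, ← hS', incl_onDomain, ← hR.map_comm, ← _root_.map_add]
    rfl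
  -- Larger times are reached in increments of `σ` through the composition law, so admissibility at
  -- one time is enough.
  have hall : ∀ t : ℝ≥0, ∃ S : X₂ →L[𝕜] X₁,
      ∀ x, R (S (DomainSpace.incl _ x)) = T₁.cascadeIntegral T₂ b C t x := by
    intro t
    have key : ∀ n : ℕ, ∀ t ≤ n • σ, ∃ S : X₂ →L[𝕜] X₁,
        ∀ x, R (S (DomainSpace.incl _ x)) = T₁.cascadeIntegral T₂ b C t x := by
      intro n
      induction n with
      | zero =>
        intro t ht
        exact hsmall t (ht.trans (by simp))
      | succ n ih =>
        intro t ht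
        rcases le_total t σ with h | h
        · exact hsmall t h
        · obtain ⟨S, hS⟩ := hsmall σ le_rfl
          obtain ⟨S', hS'⟩ := ih (t - σ) (by rwa [tsub_le_iff_right, ← succ_nsmul])
          refine ⟨_, fun x => (hadd hS hS' x).trans ?_⟩
          rw [← NNReal.coe_add, add_tsub_cancel_of_le h]
    obtain ⟨n, hn⟩ := Archimedean.arch t hσ
    exact key n t hn
  choose S hS using hall
  -- The first bound is uniform in `t`; the second, on `D(A₂)`, tends to zero with `√t`. Together
  -- with density they give strong continuity at `0`.
  have hbound : ∀ t ≤ σ, ∀ x : DomainSpace T₂.generator,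
      ‖S t (DomainSpace.incl _ x)‖ ≤ K * √K' * ‖DomainSpace.incl _ x‖ ∧
      ∀ m, 0 ≤ m → (∀ s ≤ t, ‖C (T₂.onDomain s x)‖ ≤ m) →
        ‖S t (DomainSpace.incl _ x)‖ ≤ K * (√t * m) := by
    intro t ht x
    have htτ : (t : ℝ) ≤ τ := (NNReal.coe_le_coe.2 ht).trans hστ.1
    have htτ' : (t : ℝ) ≤ τ' := (NNReal.coe_le_coe.2 ht).trans hστ.2
    obtain ⟨z, hz, hzb⟩ := hin t htτ _ (hmem t x)
    rw [← hint, ← hS] at hz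
    rw [← hR.injective hz]
    refine ⟨hzb.trans ?_, fun m hm0 hm => hzb.trans ?_⟩
    · rw [mul_assoc]
      exact mul_le_mul_of_nonneg_left (T₂.eLpNorm_output_le C x (hK' x) htτ') hK.le
    · refine mul_le_mul_of_nonneg_left ?_ hK.le
      have h1 := eLpNorm_le_of_ae_bound (p := 2) (μ := volume.restrict (Set.Ioc 0 (t : ℝ)))
        (f := fun s : ℝ => C (T₂.onDomain ((t : ℝ) - s).toNNReal x)) (C := m)
        ((ae_restrict_mem measurableSet_Ioc).mono fun s hs => hm _ (by
          rw [Real.toNNReal_le_iff_le_coe]; linarith [hs.1]))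
      refine (ENNReal.toReal_mono ?_ h1).trans (le_of_eq ?_)
      · exact ENNReal.mul_ne_top (ENNReal.rpow_ne_top_of_nonneg (by norm_num)
          (measure_ne_top _ _)) ENNReal.ofReal_ne_top
      · rw [ENNReal.toReal_mul, ENNReal.toReal_ofReal hm0, ← ENNReal.toReal_rpow,
          Measure.restrict_apply_univ, Real.volume_Ioc, sub_zero,
          ENNReal.toReal_ofReal t.coe_nonneg, Real.sqrt_eq_rpow]
        norm_num
  refine ⟨S, hS, ?_, fun s t => ?_, fun x => ?_⟩
  · refine eq_of_forall_incl (T₂ := T₂) hR fun x => ?_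
    rw [hS]
    simp [cascadeIntegral]
  · refine eq_of_forall_incl (T₂ := T₂) hR fun x => ?_
    rw [hS, NNReal.coe_add]
    exact (hadd (hS s) (hS t) x).symm
  · have hσ' : ∀ᶠ t : ℝ≥0 in 𝓝[>] 0, t ≤ σ := nhdsWithin_le_nhds (Iic_mem_nhds hσ)
    have hD : ∀ x : DomainSpace T₂.generator,
        Tendsto (fun t => S t (DomainSpace.incl _ x)) (𝓝[>] 0) (𝓝 0) := by
      intro x
      obtain ⟨m, hm⟩ := isCompact_Icc.exists_bound_of_continuousOn (s := Set.Icc 0 σ)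
        (C.continuous.comp (T₂.continuous_onDomain x)).continuousOn
      have hm0 : 0 ≤ m := (norm_nonneg _).trans (hm 0 ⟨le_rfl, hσ.le⟩)
      have hlim : Tendsto (fun t : ℝ≥0 => K * (√t * m)) (𝓝[>] 0) (𝓝 0) := by
        have : Continuous fun t : ℝ≥0 => K * (√(t : ℝ) * m) := by fun_prop
        simpa using (this.tendsto 0).mono_left nhdsWithin_le_nhds
      refine squeeze_zero_norm' ?_ hlim
      filter_upwards [hσ'] with t ht
      exact (hbound t ht x).2 m hm0 fun s hs => hm s ⟨zero_le, hs.trans ht⟩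
    have hSb : ∀ t ≤ σ, ∀ x, ‖S t x‖ ≤ K * √K' * ‖x‖ := fun t ht x => by
      refine T₂.dense_generator_domain.induction
        (P := fun x => ‖S t x‖ ≤ K * √K' * ‖x‖) (fun y hy => ?_) ?_ x
      · exact (hbound t ht (DomainSpace.mk y hy)).1
      · exact isClosed_le (by fun_prop) (by fun_prop)
    rw [Metric.tendsto_nhds]
    intro ε hε
    set k := K * √K' with hk
    have hk0 : 0 ≤ k := by positivity
    obtain ⟨y, hy, hd⟩ := T₂.dense_generator_domain.exists_dist_lt x
      (show 0 < ε / (2 * (k + 1)) by positivity)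
    filter_upwards [hσ', Metric.tendsto_nhds.1 (hD (DomainSpace.mk y hy)) (ε / 2) (by positivity)]
      with t ht h2
    change dist (S t y) 0 < _ at h2
    rw [dist_zero_right] at h2 ⊢
    rw [dist_eq_norm] at hd
    have h3 := hSb t ht (x - y)
    rw [_root_.map_sub] at h3
    have h4 : ‖S t x‖ ≤ ‖S t x - S t y‖ + ‖S t y‖ := by
      simpa using norm_add_le (S t x - S t y) (S t y)
    have h5 : (k + 1) * ‖x - y‖ < ε / 2 := by
      calc _ < (k + 1) * (ε / (2 * (k + 1))) := by gcongr
        _ = _ := by field_simp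
    nlinarith [norm_nonneg (x - y)]

end Cascade

/-! ### Triangular semigroups and their stability. -/

section Triangular

variable {𝕜 X₁ X₂ : Type*} [RCLike 𝕜] [NormedAddCommGroup X₁] [NormedSpace 𝕜 X₁]
  [NormedAddCommGroup X₂] [NormedSpace 𝕜 X₂]

theorem _root_.WithLp.norm_fst_le_two (p : WithLp 2 (X₁ × X₂)) : ‖p.fst‖ ≤ ‖p‖ := by
  have := WithLp.prod_norm_sq_eq_of_L2 p
  exact le_of_sq_le_sq (by nlinarith [sq_nonneg ‖p.snd‖]) (norm_nonneg _)

theorem _root_.WithLp.norm_snd_le_two (p : WithLp 2 (X₁ × X₂)) : ‖p.snd‖ ≤ ‖p‖ := by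
  have := WithLp.prod_norm_sq_eq_of_L2 p
  exact le_of_sq_le_sq (by nlinarith [sq_nonneg ‖p.fst‖]) (norm_nonneg _)

theorem _root_.WithLp.norm_le_add_two (p : WithLp 2 (X₁ × X₂)) : ‖p‖ ≤ ‖p.fst‖ + ‖p.snd‖ := by
  refine le_of_sq_le_sq ?_ (by positivity)
  rw [WithLp.prod_norm_sq_eq_of_L2]
  nlinarith [norm_nonneg p.fst, norm_nonneg p.snd]

/-- The `C₀`-semigroup `(x₁, x₂) ↦ (T₁(t) x₁ + S(t) x₂, T₂(t) x₂)`. -/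
noncomputable def triangular (T₁ : C0Semigroup 𝕜 X₁) (T₂ : C0Semigroup 𝕜 X₂)
    (S : ℝ≥0 → X₂ →L[𝕜] X₁) (h0 : S 0 = 0)
    (hadd : ∀ s t, S (s + t) = (T₁.toFun s).comp (S t) + (S s).comp (T₂.toFun t))
    (hS : ∀ x, Tendsto (fun t => S t x) (𝓝[>] 0) (𝓝 0)) :
    C0Semigroup 𝕜 (WithLp 2 (X₁ × X₂)) where
  toFun t := (WithLp.prodContinuousLinearEquiv 2 𝕜 X₁ X₂).symm.toContinuousLinearMap ∘L
    (((T₁.toFun t).comp (ContinuousLinearMap.fst 𝕜 X₁ X₂)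
      + (S t).comp (ContinuousLinearMap.snd 𝕜 X₁ X₂)).prod
      ((T₂.toFun t).comp (ContinuousLinearMap.snd 𝕜 X₁ X₂))) ∘L
    (WithLp.prodContinuousLinearEquiv 2 𝕜 X₁ X₂).toContinuousLinearMap
  map_zero := by
    ext p
    refine WithLp.ofLp_injective 2 (Prod.ext ?_ ?_)
    · show T₁.toFun 0 p.fst + S 0 p.snd = p.fst
      rw [h0, T₁.map_zero_apply]
      simp
    · exact T₂.map_zero_apply _
  map_add s t := by
    ext p
    refine WithLp.ofLp_injective 2 (Prod.ext ?_ ?_)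
    · show T₁.toFun (s + t) p.fst + S (s + t) p.snd
        = T₁.toFun s (T₁.toFun t p.fst + S t p.snd) + S s (T₂.toFun t p.snd)
      rw [hadd, T₁.map_add_apply, _root_.map_add, add_assoc]
      rfl
    · exact T₂.map_add_apply s t _
  tendsto_zero p := by
    refine ((WithLp.prodContinuousLinearEquiv 2 𝕜 X₁ X₂).symm.continuous.tendsto
      (p.fst, p.snd)).comp (Tendsto.prodMk_nhds ?_ (T₂.tendsto_zero p.snd))
    simpa using (T₁.tendsto_zero p.fst).add (hS p.snd)

variable {T₁ : C0Semigroup 𝕜 X₁} {T₂ : C0Semigroup 𝕜 X₂} {S : ℝ≥0 → X₂ →L[𝕜] X₁}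
  (h0 : S 0 = 0)
  (hadd : ∀ s t, S (s + t) = (T₁.toFun s).comp (S t) + (S s).comp (T₂.toFun t))
  (hS : ∀ x, Tendsto (fun t => S t x) (𝓝[>] 0) (𝓝 0))

theorem triangular_apply_fst (t : ℝ≥0) (p : WithLp 2 (X₁ × X₂)) :
    ((T₁.triangular T₂ S h0 hadd hS).toFun t p).fst = T₁.toFun t p.fst + S t p.snd := rfl

theorem triangular_apply_snd (t : ℝ≥0) (p : WithLp 2 (X₁ × X₂)) :
    ((T₁.triangular T₂ S h0 hadd hS).toFun t p).snd = T₂.toFun t p.snd := rfl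

theorem norm_triangular_le (t : ℝ≥0) : ‖(T₁.triangular T₂ S h0 hadd hS).toFun t‖
    ≤ ‖T₁.toFun t‖ + ‖S t‖ + ‖T₂.toFun t‖ := by
  refine ContinuousLinearMap.opNorm_le_bound _ (by positivity) fun p => ?_
  refine (WithLp.norm_le_add_two _).trans ?_
  rw [triangular_apply_fst, triangular_apply_snd]
  have h1 := (T₁.toFun t).le_opNorm_of_le (WithLp.norm_fst_le_two p)
  have h2 := (S t).le_opNorm_of_le (WithLp.norm_snd_le_two p)
  have h3 := (T₂.toFun t).le_opNorm_of_le (WithLp.norm_snd_le_two p)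
  have h4 := norm_add_le (T₁.toFun t p.fst) (S t p.snd)
  linarith

theorem ExponentiallyStable.eventually_norm_le {T : C0Semigroup 𝕜 X₁}
    (h : T.ExponentiallyStable) {ε : ℝ} (hε : 0 < ε) :
    ∀ᶠ t : ℝ≥0 in atTop, ‖T.toFun t‖ ≤ ε := by
  obtain ⟨L, hL, ω, hω, hb⟩ := h
  have h1 : Tendsto (fun t : ℝ≥0 => L * Real.exp (-(ω * t))) atTop (𝓝 0) := by
    have := Real.tendsto_exp_neg_atTop_nhds_zero.comp
      ((NNReal.tendsto_coe_atTop.2 tendsto_id).const_mul_atTop hω)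
    simpa using this.const_mul L
  filter_upwards [h1.eventually_le_const hε] with t ht
  refine (hb t).trans ?_
  rwa [neg_mul]

theorem norm_nsmul_le_pow (T : C0Semigroup 𝕜 X₁) {t : ℝ≥0} {q : ℝ} (hT : ‖T.toFun t‖ ≤ q)
    (n : ℕ) : ‖T.toFun (n • t)‖ ≤ q ^ n := by
  have hq : 0 ≤ q := (norm_nonneg _).trans hT
  induction n with
  | zero =>
    rw [zero_smul, T.map_zero, pow_zero]
    exact ContinuousLinearMap.norm_id_le
  | succ n ih =>
    rw [succ_nsmul, T.map_add, pow_succ]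
    exact (ContinuousLinearMap.opNorm_comp_le _ _).trans
      (mul_le_mul ih hT (norm_nonneg _) (by positivity))

/-- Choose a time at which both diagonal norms are at most `1 / 4`; iterating the law for `S` along
its multiples makes all three entries decay. -/
theorem ExponentiallyStable.triangular [CompleteSpace X₁] [CompleteSpace X₂]
    (h₁ : T₁.ExponentiallyStable) (h₂ : T₂.ExponentiallyStable) :
    (T₁.triangular T₂ S h0 hadd hS).ExponentiallyStable := by
  obtain ⟨t, ht1, ht2, ht0⟩ := ((h₁.eventually_norm_le (show (0 : ℝ) < 1 / 4 by norm_num)).and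
    ((h₂.eventually_norm_le (show (0 : ℝ) < 1 / 4 by norm_num)).and
    (eventually_gt_atTop 0))).exists
  -- The recursion is `aₙ₊₁ ≤ aₙ / 4 + ‖S t‖ / 4 ^ n`. Relaxing to rate `1 / 2` avoids the resonant
  -- factor `n`, and the constant `4` closes the induction.
  have hSn : ∀ n : ℕ, ‖S (n • t)‖ ≤ 4 * ‖S t‖ * (1 / 2) ^ n := by
    intro n
    induction n with
    | zero => rw [zero_smul, h0, norm_zero]; positivity
    | succ n ih =>
      rw [succ_nsmul', hadd]
      have e1 : ‖(T₁.toFun t).comp (S (n • t))‖ ≤ 1 / 4 * (4 * ‖S t‖ * (1 / 2) ^ n) :=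
        (ContinuousLinearMap.opNorm_comp_le _ _).trans
          (mul_le_mul ht1 ih (norm_nonneg _) (by norm_num))
      have e2 : ‖(S t).comp (T₂.toFun (n • t))‖ ≤ ‖S t‖ * (1 / 2) ^ n := by
        refine (ContinuousLinearMap.opNorm_comp_le _ _).trans ?_
        refine mul_le_mul_of_nonneg_left ((T₂.norm_nsmul_le_pow ht2 n).trans ?_) (norm_nonneg _)
        exact pow_le_pow_left₀ (by norm_num) (by norm_num) n
      refine (norm_add_le _ _).trans ((add_le_add e1 e2).trans (le_of_eq ?_))
      ring
  have hlim : Tendsto (fun n : ℕ => (1 / 4 : ℝ) ^ n + 4 * ‖S t‖ * (1 / 2) ^ n + (1 / 4) ^ n)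
      atTop (𝓝 0) := by
    have e1 := tendsto_pow_atTop_nhds_zero_of_lt_one (r := (1 / 4 : ℝ)) (by norm_num) (by norm_num)
    have e2 := tendsto_pow_atTop_nhds_zero_of_lt_one (r := (1 / 2 : ℝ)) (by norm_num) (by norm_num)
    simpa using (e1.add (e2.const_mul (4 * ‖S t‖))).add e1
  obtain ⟨n, hn, hn0⟩ := ((hlim.eventually_lt_const one_pos).and (eventually_gt_atTop 0)).exists
  refine exponentiallyStable_of_norm_lt_one _ (t₀ := n • t) (nsmul_pos ht0 hn0.ne') ?_
  refine (norm_triangular_le h0 hadd hS _).trans_lt (lt_of_le_of_lt ?_ hn)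
  gcongr
  · exact T₁.norm_nsmul_le_pow ht1 n
  · exact hSn n
  · exact T₂.norm_nsmul_le_pow ht2 n

theorem tendsto_fst_of_mem_graph {T : C0Semigroup 𝕜 (WithLp 2 (X₁ × X₂))}
    {p q : WithLp 2 (X₁ × X₂)} (h : (p, q) ∈ T.generator.graph) :
    Tendsto (fun t : ℝ≥0 => ((t : ℝ) : 𝕜)⁻¹ • ((T.toFun t p).fst - p.fst)) (𝓝[>] 0)
      (𝓝 q.fst) :=
  ((WithLp.prod_continuous_ofLp 2 X₁ X₂).fst.tendsto q).comp (T.mem_graph_generator.1 h)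

theorem tendsto_snd_of_mem_graph {T : C0Semigroup 𝕜 (WithLp 2 (X₁ × X₂))}
    {p q : WithLp 2 (X₁ × X₂)} (h : (p, q) ∈ T.generator.graph) :
    Tendsto (fun t : ℝ≥0 => ((t : ℝ) : 𝕜)⁻¹ • ((T.toFun t p).snd - p.snd)) (𝓝[>] 0)
      (𝓝 q.snd) :=
  ((WithLp.prod_continuous_ofLp 2 X₁ X₂).snd.tendsto q).comp (T.mem_graph_generator.1 h)

end Triangular

/-! ### Identification of the generator with the cascade operator. -/

section Cascade

variable {𝕜 X₁ X₂ U : Type*} [RCLike 𝕜]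
  [NormedAddCommGroup X₁] [InnerProductSpace 𝕜 X₁] [NormedSpace ℝ X₁] [CompleteSpace X₁]
  [NormedAddCommGroup X₂] [InnerProductSpace 𝕜 X₂] [NormedSpace ℝ X₂] [CompleteSpace X₂]
  [NormedAddCommGroup U] [NormedSpace 𝕜 U] {T₁ : C0Semigroup 𝕜 X₁} {T₂ : C0Semigroup 𝕜 X₂}
  {B : U →L[𝕜] ExtrapolationSpace T₁.generator} {C : DomainSpace T₂.generator →L[𝕜] U}

/-- The cascade operator in terms of `R = (c - A₁)⁻¹` and `b = (c - Ã₁)⁻¹ B₁`. -/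
theorem mem_cascadeGraph_iff {c : ℝ} {R : X₁ →L[𝕜] X₁} (hR : T₁.IsResolvent c R)
    {b : U →L[𝕜] X₁} (hb : ∀ u, B u = (c : 𝕜) • pivotEmbedding T₁.generator (b u)
      - extendedOperator T₁.generator (b u)) {p q : WithLp 2 (X₁ × X₂)} :
    (p, q) ∈ cascadeGraph T₁.generator T₂.generator B C ↔
      ∃ x : DomainSpace T₂.generator, DomainSpace.incl _ x = p.snd ∧
        DomainSpace.op _ x = q.snd ∧ R q.fst = (c : 𝕜) • R p.fst - p.fst + b (C x) := by
  obtain ⟨E, hE, hER⟩ := hR.exists_equiv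
  -- Applying the inverse of `c - Ã₁` turns the equation in `[D(A₁*)]'` into one in `X₁`.
  have key : ∀ u, pivotEmbedding T₁.generator q.fst
      = extendedOperator T₁.generator p.fst + B u ↔
      R q.fst = (c : 𝕜) • R p.fst - p.fst + b u := fun u => by
    have h1 : B u = E (b u) := by rw [hb, hE]
    have h2 : extendedOperator T₁.generator p.fst = E ((c : 𝕜) • R p.fst - p.fst) := by
      rw [_root_.map_sub, _root_.map_smul, hER, hE, sub_sub_cancel]
    rw [h1, h2, ← hER, ← _root_.map_add, E.injective.eq_iff]
  constructor
  · rintro ⟨h, hΛ, e1, e2⟩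
    refine ⟨DomainSpace.mk p.snd h, rfl, e2.symm, (key _).1 ?_⟩
    rw [← T₂.lambdaExtension_incl C (DomainSpace.mk p.snd h) hΛ]
    exact e1
  · rintro ⟨x, e1, e2, e3⟩
    obtain ⟨p₁, p₂, rfl⟩ : ∃ p₁ p₂, p = WithLp.toLp 2 (p₁, p₂) := ⟨p.fst, p.snd, rfl⟩
    obtain rfl : DomainSpace.incl _ x = p₂ := e1
    refine ⟨DomainSpace.incl_mem x, T₂.mem_lambdaExtension_domain C x, ?_, e2.symm⟩
    have := T₂.lambdaExtension_incl C x (T₂.mem_lambdaExtension_domain C x)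
    refine ((key _).2 e3).trans ?_
    congr 2
    exact this.symm

variable {S : ℝ≥0 → X₂ →L[𝕜] X₁} (h0 : S 0 = 0)
  (hadd : ∀ s t, S (s + t) = (T₁.toFun s).comp (S t) + (S s).comp (T₂.toFun t))
  (hS : ∀ x, Tendsto (fun t => S t x) (𝓝[>] 0) (𝓝 0))

/-- The second component puts `p.snd` in `D(A₂)`, where `R S(t)` is the cascade integral; then the
first component is differentiated at `0` after applying `R`. -/
theorem generator_triangular_graph_le {c : ℝ} {R : X₁ →L[𝕜] X₁} (hR : T₁.IsResolvent c R)
    {b : U →L[𝕜] X₁} (hb : ∀ u, B u = (c : 𝕜) • pivotEmbedding T₁.generator (b u)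
      - extendedOperator T₁.generator (b u))
    (hRS : ∀ t x, R (S t (DomainSpace.incl _ x)) = T₁.cascadeIntegral T₂ b C t x) :
    (T₁.triangular T₂ S h0 hadd hS).generator.graph
      ≤ cascadeGraph T₁.generator T₂.generator B C := by
  rintro ⟨p, q⟩ h
  have h1 := tendsto_fst_of_mem_graph h
  have h2 := tendsto_snd_of_mem_graph h
  simp only [triangular_apply_fst, triangular_apply_snd] at h1 h2
  have h3 : (p.snd, q.snd) ∈ T₂.generator.graph := T₂.mem_graph_generator.2 h2
  rw [mem_cascadeGraph_iff hR hb]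
  set x := DomainSpace.mk p.snd (T₂.mem_domain_of_mem_graph h3) with hx
  have hxp : DomainSpace.incl _ x = p.snd := rfl
  refine ⟨x, hxp, DomainSpace.op_eq_of_mem_graph x h3, ?_⟩
  have h4 := (T₁.mem_graph_generator.1 (hR.mem_graph p.fst)).add
    (T₁.tendsto_cascadeIntegral_div T₂ b C x)
  refine tendsto_nhds_unique ((R.continuous.tendsto _).comp h1) (h4.congr fun t => ?_)
  rw [Function.comp, _root_.map_smul, _root_.map_sub, _root_.map_add, hR.map_comm, ← hxp, hRS,
    ← smul_add]
  congr 1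
  abel

/-- An operator `A` with `d - A` onto has no proper extension `A'` with `d - A'` injective.
Surjectivity comes from the resolvent of the triangular semigroup, injectivity from solving the
triangular system row by row. -/
theorem generator_triangular_eq {c : ℝ} {R : X₁ →L[𝕜] X₁} (hR : T₁.IsResolvent c R)
    {b : U →L[𝕜] X₁} (hb : ∀ u, B u = (c : 𝕜) • pivotEmbedding T₁.generator (b u)
      - extendedOperator T₁.generator (b u))
    (hRS : ∀ t x, R (S t (DomainSpace.incl _ x)) = T₁.cascadeIntegral T₂ b C t x) :
    (T₁.triangular T₂ S h0 hadd hS).generator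
      = cascadeOperator T₁.generator T₂.generator B C := by
  let _ : NormedSpace ℝ (WithLp 2 (X₁ × X₂)) := NormedSpace.restrictScalars ℝ 𝕜 _
  set T := T₁.triangular T₂ S h0 hadd hS with hT
  have hle := generator_triangular_graph_le h0 hadd hS hR hb hRS
  refine LinearPMap.eq_of_eq_graph ?_
  rw [cascadeOperator_graph _ _ _ _ T₁.isClosed_generator]
  refine le_antisymm hle ?_
  obtain ⟨d, ⟨R₁, hR₁⟩, ⟨R₂, hR₂⟩, ⟨V, hV⟩⟩ := (T₁.eventually_exists_isResolvent.and
    (T₂.eventually_exists_isResolvent.and T.eventually_exists_isResolvent)).exists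
  rintro ⟨p, q⟩ hpq
  set z := (d : 𝕜) • p - q with hz
  have h1 := hV.mem_graph z
  -- The difference `r` of the two solutions is an eigenvector of the cascade operator for `d`, or
  -- zero.
  have h2 := (cascadeGraph T₁.generator T₂.generator B C).sub_mem hpq (hle h1)
  set r := p - V z with hr
  have h3 : q - ((d : 𝕜) • V z - z) = (d : 𝕜) • r := by
    rw [hz, hr, smul_sub]; abel
  rw [Prod.mk_sub_mk, h3, mem_cascadeGraph_iff hR hb] at h2
  obtain ⟨x, hx1, hx2, hx3⟩ := h2
  have h4 : x = 0 := by
    have h5 := hR₂.apply_sub _ _ (DomainSpace.mem_graph x)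
    rw [hx2, hx1] at h5
    have h6 : (d : 𝕜) • r.snd - ((d : 𝕜) • r).snd = 0 := sub_self _
    rw [h6, _root_.map_zero, ← hx1] at h5
    exact DomainSpace.incl_injective (h5.symm.trans (_root_.map_zero _).symm)
  have h7 : r.snd = 0 := by rw [← hx1, h4, _root_.map_zero]
  rw [h4, _root_.map_zero, _root_.map_zero, add_zero] at hx3
  -- With the second component gone, the first row reads `A₁ r₁ = d r₁`, excluded by the resolvent
  -- of `A₁` at `d`.
  have h8 : r.fst = 0 := by
    have h9 : (r.fst, (d : 𝕜) • r.fst) ∈ T₁.generator.graph := by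
      rw [hR.mem_graph_iff, _root_.map_sub, _root_.map_smul]
      have : R ((d : 𝕜) • r).fst = R ((d : 𝕜) • r.fst) := rfl
      rw [← this, hx3, sub_sub_cancel]
    have h10 := hR₁.apply_sub _ _ h9
    rw [sub_self, _root_.map_zero] at h10
    exact h10.symm
  have h11 : r = 0 := WithLp.ofLp_injective 2 (Prod.ext h8 h7)
  have h12 : p = V z := sub_eq_zero.1 h11
  rw [h11, smul_zero, ← h12, sub_eq_zero] at h3
  rw [← h12, ← h3] at h1
  exact h1

end Cascade

end C0Semigroup

theorem mainTheorem5 {𝕜 X₁ X₂ U₁ : Type*} [RCLike 𝕜]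
    [NormedAddCommGroup X₁] [InnerProductSpace 𝕜 X₁] [CompleteSpace X₁]
    [NormedAddCommGroup X₂] [InnerProductSpace 𝕜 X₂] [CompleteSpace X₂]
    [NormedAddCommGroup U₁] [InnerProductSpace 𝕜 U₁] [CompleteSpace U₁]
    (T₁ : C0Semigroup 𝕜 X₁) (T₂ : C0Semigroup 𝕜 X₂)
    (B₁ : U₁ →L[𝕜] ExtrapolationSpace T₁.generator) (hB₁ : T₁.AdmissibleControl B₁)
    (C₂ : DomainSpace T₂.generator →L[𝕜] U₁) (hC₂ : T₂.AdmissibleObservation C₂) :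
    ∃ T : C0Semigroup 𝕜 (WithLp 2 (X₁ × X₂)),
      T.generator = cascadeOperator T₁.generator T₂.generator B₁ C₂ ∧
      (T₁.ExponentiallyStable → T₂.ExponentiallyStable → T.ExponentiallyStable) := by
  let _ : NormedSpace ℝ X₁ := NormedSpace.restrictScalars ℝ 𝕜 X₁
  let _ : NormedSpace ℝ X₂ := NormedSpace.restrictScalars ℝ 𝕜 X₂
  obtain ⟨c, R, hR⟩ := T₁.eventually_exists_isResolvent.exists
  obtain ⟨E, hE, -⟩ := hR.exists_equiv
  -- `b = (c - Ã₁)⁻¹ B₁` replaces the unbounded control operator by one with values in `X₁`.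
  set b : U₁ →L[𝕜] X₁ := E.symm.toContinuousLinearMap ∘L B₁ with hbdef
  have hb : ∀ u, B₁ u = (c : 𝕜) • pivotEmbedding T₁.generator (b u)
      - extendedOperator T₁.generator (b u) := fun u => by
    rw [← hE]
    exact (E.apply_symm_apply _).symm
  obtain ⟨τ, hτ, K, hK, hin⟩ := hB₁.exists_bound hR hb
  obtain ⟨S, hRS, h0, hadd, hS⟩ := C0Semigroup.exists_cascade_operators hR hτ hK hin hC₂
  exact ⟨T₁.triangular T₂ S h0 hadd hS, C0Semigroup.generator_triangular_eq h0 hadd hS hR hb hRS,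
    fun h₁ h₂ => h₁.triangular h0 hadd hS h₂⟩
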